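/- Let $s,m,n\in\mathbb{N}$. A linear time-and-space-invariant (LTSI) system $\Sigma$: $\dot z=\mathcal{A}z+\mathcal{B}u$, $y=\mathcal{C}z$ has input and output space $\mathcal{U}=\mathcal{Y}=L_2(\mathbb{R}^s,\mathbb{C}^m)$, state space $\mathcal{Z}=L_2(\mathbb{R}^s,\mathbb{C}^n)$, a densely defined translation-invariant operator $\mathcal{A}:\mathcal{Z}\supset\mathscr{D}(\mathcal{A})\to\mathcal{Z}$, bounded translation-invariant operators $\mathcal{B}:\mathcal{U}\to\mathcal{Z}$, $\mathcal{C}:\mathcal{Z}\to\mathcal{Y}$, and continuous Fourier symbols $\hat A,\hat B,\hat C$, i.e. $\widehat{\mathcal{A}f}(\omega)=\hat A_\omega\hat f(\omega)$ for $f\in\mathscr{D}(\mathcal{A})$, etc., with $\hat f(\omega)=(2\pi)^{-s/2}\int e^{-i\langle\omega,x\rangle}f(x)\,dx$. Its impulse response $\mathcal{G}(t)$, $t\ge0$, is the translation-invariant operator with Fourier symbol $\omega\mapsto\hat C_\omega e^{\hat A_\omega t}\hat B_\omega$ on its maximal domain. $\Sigma$ is *well-posed* if $\mathcal{A}$ generates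 a $C_0$-semigroup $(\exp(\mathcal{A}t))_{t\ge0}$; then its impulse response is $\mathcal{C}\exp(\mathcal{A}t)\mathcal{B}$. $\Sigma$ is *reciprocal* if $\mathcal{G}(t)$ is self-adjoint for all $t\ge0$, and *weakly impedance passive* if for every $\omega$ there is $P\ge0$ with $\hat A_\omega^*P+P\hat A_\omega\le0$ and $\hat C_\omega^*=P\hat B_\omega$. A well-posed system is *internally impedance passive* if $\tfrac12\|z(t)\|^2\le\tfrac12\|z(0)\|^2+\int_0^t\operatorname{Re}\langle u(\tau),y(\tau)\rangle\,d\tau$ for all $t\ge0$, all $z(0)\in\mathcal{Z}$ and all $u\in L_2([0,t],\mathcal{U})$, along mild solutions. It is *self-dual* if there is a bounded, boundedly invertible, translation-invariant $\mathcal{D}$ on $\mathcal{Z}$ carrying it to its dual: $\mathcal{D}\mathcal{A}=\mathcal{A}^*\mathcal{D}$ (with $\mathcal{D}\,\mathscr{D}(\mathcal{A})=\mathscr{D}(\mathcal{A}^*)$), $\mathcal{D}\mathcal{B}=\mathcal{C}^*$ and $\mathcal{B}^*\mathcal{D}=\mathcal{C}$. **Theorem.** Let $\Sigma$ be a reciprocal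 and weakly impedance passive LTSI system such that $(\hat A_\omega,\hat B_\omega,\hat C_\omega)$ is minimal (controllable and observable) for every $\omega\in\mathbb{R}^s$. Let $\hat S,\hat Q:\mathbb{R}^s\to\mathbb{C}^{n\times n}$ be continuous and pointwise invertible such that, for all $\omega$, $$\hat S_\omega=\hat S_\omega^*,\quad \hat A_\omega^*\hat S_\omega=\hat S_\omega\hat A_\omega,\quad \hat C_\omega^*=\hat S_\omega\hat B_\omega,$$ $$\hat Q_\omega>0,\quad \hat A_\omega^*\hat Q_\omega+\hat Q_\omega\hat A_\omega\le0,\quad \hat C_\omega^*=\hat Q_\omega\hat B_\omega,\quad \hat Q_\omega=\hat S_\omega\hat Q_\omega^{-1}\hat S_\omega,$$ and suppose that $\sup_{\omega}\|\hat C_\omega\hat S_\omega^{-1}\hat Q_\omega\hat B_\omega\|<\infty$. Then there is a well-posed LTSI system $\bar\Sigma=(\bar{\mathcal{A}},\bar{\mathcal{B}},\bar{\mathcal{C}})$ with the same state space $\bar{\mathcal{Z}}=\mathcal{Z}$ and with impulse response $\mathcal{G}$, i.e. $\bar{\mathcal{C}}\exp(\bar{\mathcal{A}}t)\bar{\mathcal{B}}=\mathcal{G}(t)$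 for all $t\ge0$, that is both internally impedance passive and self-dual. Furthermore, for some $n_1+n_2=n$ and the partition $\bar{\mathcal{Z}}=\bar{\mathcal{Z}}_1\times\bar{\mathcal{Z}}_2$ with $\bar{\mathcal{Z}}_k=L_2(\mathbb{R}^s,\mathbb{C}^{n_k})$ (first $n_1$ and last $n_2$ components), $$\bar{\mathcal{A}}=\begin{bmatrix}\bar{\mathcal{A}}_{11}&\bar{\mathcal{A}}_{12}\\-\bar{\mathcal{A}}_{12}^*&\bar{\mathcal{A}}_{22}\end{bmatrix},\qquad \bar{\mathcal{C}}^*=\bar{\mathcal{B}}=\begin{bmatrix}\bar{\mathcal{B}}_1\\0\end{bmatrix},$$ where $\bar{\mathcal{A}}_{11},\bar{\mathcal{A}}_{12},\bar{\mathcal{A}}_{22}$ are densely defined and translation invariant, $\bar{\mathcal{A}}_{11}$ and $\bar{\mathcal{A}}_{22}$ are self-adjoint and nonpositive, $\bar{\mathcal{B}}_1$ is bounded, and the equality for $\bar{\mathcal{A}}$ means that $\bar{\mathcal{A}}$ is the closure of the operator matrix on its natural domain $(\mathscr{D}(\bar{\mathcal{A}}_{11})\cap\mathscr{D}(\bar{\mathcal{A}}_{12}^*))\times(\mathscr{D}(\bar{\mathcal{A}}_{12})\cap\mathscr{D}(\bar{\mathcal{A}}_{22}))$.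 -/

import Mathlib

open MeasureTheory Filter Topology FourierTransform
open scoped Matrix LinearPMap ComplexOrder

noncomputable section

/-- The spatial (and frequency) domain `ℝ^s`. -/
abbrev Space (s : ℕ) : Type := EuclideanSpace ℝ (Fin s)

/-- The Hilbert space `L₂(ℝ^s, ℂ^n)`. -/
abbrev L2 (s n : ℕ) : Type :=
  Lp (EuclideanSpace ℂ (Fin n)) 2 (volume : Measure (Space s))

namespace LTSI

/-! ### Translation invariant operators and Fourier symbols -/

/-- The translation `f ↦ f (· + x)` on `L₂(ℝ^s, ℂ^n)`. -/
def translate {s n : ℕ} (x : Space s) (f : L2 s n) : L2 s n :=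
  Lp.compMeasurePreserving (fun y => y + x) (measurePreserving_add_right volume x) f

/-- A bounded operator regarded as an everywhere defined partial operator. -/
def everywhere {E F : Type*} [NormedAddCommGroup E] [NormedSpace ℂ E]
    [NormedAddCommGroup F] [NormedSpace ℂ F] (T : E →L[ℂ] F) : E →ₗ.[ℂ] F :=
  (T : E →ₗ[ℂ] F).toPMap ⊤

/-- Translation invariance of a possibly unbounded operator: translations preserve the domain
and commute with the operator. -/
def IsTranslationInvariant {s n m : ℕ} (T : L2 s n →ₗ.[ℂ] L2 s m) : Prop :=
  ∀ (x : Space s) (f : T.domain),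
    ∃ h : translate x (f : L2 s n) ∈ T.domain, T ⟨translate x (f : L2 s n), h⟩ = translate x (T f)

/-- The pointwise product `ξ ↦ a (2πξ) (𝓕 f) (ξ)`.

Mathlib's transform is `(𝓕 f) ξ = ∫ exp (-2πi⟨ξ, x⟩) f x`, so the unitary transform
`f̂ ω = (2π)^(-s/2) ∫ exp (-i⟨ω, x⟩) f x` in angular frequency is
`f̂ ω = (2π)^(-s/2) (𝓕 f) (ω / 2π)`, and the multiplication `ω ↦ a ω (f̂ ω)` is, in terms of `𝓕 f`
at `ξ = ω / 2π`, the product below. With this scaling `∂/∂x` has the symbol `iω`. -/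
def symbolMul {s n m : ℕ} (a : Space s → Matrix (Fin m) (Fin n) ℂ) (f : L2 s n) :
    Space s → EuclideanSpace ℂ (Fin m) :=
  fun ξ => WithLp.toLp 2 (a ((2 * Real.pi) • ξ) *ᵥ WithLp.ofLp ((𝓕 f : L2 s n) ξ))

/-- `a` is a Fourier symbol of `T`: the Fourier transform of `T f` is `a` times that of `f`. -/
def HasFourierSymbol {s n m : ℕ} (T : L2 s n →ₗ.[ℂ] L2 s m)
    (a : Space s → Matrix (Fin m) (Fin n) ℂ) : Prop :=
  ∀ f : T.domain, ((𝓕 (T f) : L2 s m) : Space s → _) =ᵐ[volume] symbolMul a (f : L2 s n)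

lemma symbolMul_add {s n m : ℕ} (a : Space s → Matrix (Fin m) (Fin n) ℂ) (f g : L2 s n) :
    symbolMul a (f + g) =ᵐ[volume] symbolMul a f + symbolMul a g := by
  have h : (𝓕 (f + g) : L2 s n) = 𝓕 f + 𝓕 g := FourierTransform.fourier_add f g
  filter_upwards [Lp.coeFn_add (𝓕 f : L2 s n) (𝓕 g)] with ξ hξ
  simp only [symbolMul, h, hξ, Pi.add_apply, WithLp.ofLp_add, Matrix.mulVec_add, WithLp.toLp_add]

lemma symbolMul_smul {s n m : ℕ} (a : Space s → Matrix (Fin m) (Fin n) ℂ) (c : ℂ) (f : L2 s n) :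
    symbolMul a (c • f) =ᵐ[volume] c • symbolMul a f := by
  have h : (𝓕 (c • f) : L2 s n) = c • 𝓕 f := FourierTransform.fourier_smul c f
  filter_upwards [Lp.coeFn_smul c (𝓕 f : L2 s n)] with ξ hξ
  simp only [symbolMul, h, hξ, Pi.smul_apply, WithLp.ofLp_smul, Matrix.mulVec_smul,
    WithLp.toLp_smul]

/-- The translation invariant operator with Fourier symbol `a`, on its natural (maximal) domain of
all `f ∈ L₂` for which `a f̂ ∈ L₂`. -/
def multiplier {s n m : ℕ} (a : Space s → Matrix (Fin m) (Fin n) ℂ) : L2 s n →ₗ.[ℂ] L2 s m where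
  domain :=
    { carrier := {f | MemLp (symbolMul a f) 2 volume}
      add_mem' := fun {f g} hf hg => (memLp_congr_ae (symbolMul_add a f g)).2 (hf.add hg)
      zero_mem' := by
        have h := symbolMul_smul a (0 : ℂ) (0 : L2 s n)
        rw [zero_smul, zero_smul] at h
        exact (memLp_congr_ae h).2 MemLp.zero
      smul_mem' := fun c f hf => (memLp_congr_ae (symbolMul_smul a c f)).2 (hf.const_smul c) }
  toFun :=
    { toFun := fun f => (𝓕⁻ (MemLp.toLp (symbolMul a (f : L2 s n)) f.2 : L2 s m) : L2 s m)
      map_add' := fun f g => by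
        rw [← FourierTransform.fourierInv_add, ← MemLp.toLp_add]
        congr 1
        exact MemLp.toLp_congr _ _ (symbolMul_add a f g)
      map_smul' := fun c f => by
        rw [RingHom.id_apply, ← FourierTransform.fourierInv_smul, ← MemLp.toLp_const_smul]
        congr 1
        exact MemLp.toLp_congr _ _ (symbolMul_smul a c f) }

/-! ### Strongly continuous semigroups -/

/-- A `C₀`-semigroup of bounded operators; only the values at times `t ≥ 0` are relevant. -/
structure C0Semigroup (Z : Type*) [NormedAddCommGroup Z] [NormedSpace ℂ Z] where
  /-- The operator at time `t`. -/
  op : ℝ → Z →L[ℂ] Z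
  map_zero : op 0 = ContinuousLinearMap.id ℂ Z
  map_add : ∀ t r : ℝ, 0 ≤ t → 0 ≤ r → op (t + r) = (op t).comp (op r)
  tendsto_zero : ∀ z : Z, Tendsto (fun t => op t z) (𝓝[>] 0) (𝓝 z)

/-- `A` is the infinitesimal generator of `T`: its domain consists of all `z` for which
`(T t z - z) / t` converges as `t ↓ 0`, and `A z` is the limit. -/
def C0Semigroup.HasGenerator {Z : Type*} [NormedAddCommGroup Z] [NormedSpace ℂ Z]
    (T : C0Semigroup Z) (A : Z →ₗ.[ℂ] Z) : Prop :=
  ∀ z w : Z, (z, w) ∈ A.graph ↔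
    Tendsto (fun t : ℝ => (t⁻¹ : ℝ) • (T.op t z - z)) (𝓝[>] 0) (𝓝 w)

/-! ### State-space systems -/

/-- The operators of the state-space system `ż = A z + B u`, `y = C z`. -/
structure StateSystem (U Z Y : Type*) [NormedAddCommGroup U] [InnerProductSpace ℂ U]
    [NormedAddCommGroup Z] [InnerProductSpace ℂ Z]
    [NormedAddCommGroup Y] [InnerProductSpace ℂ Y] where
  /-- The state operator. -/
  A : Z →ₗ.[ℂ] Z
  /-- The input operator. -/
  B : U →L[ℂ] Z
  /-- The output operator. -/
  C : Z →L[ℂ] Y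

namespace StateSystem

variable {U Z Y : Type*} [NormedAddCommGroup U] [InnerProductSpace ℂ U] [CompleteSpace U]
  [NormedAddCommGroup Z] [InnerProductSpace ℂ Z] [CompleteSpace Z]
  [NormedAddCommGroup Y] [InnerProductSpace ℂ Y] [CompleteSpace Y]

/-- The dual system `ż = A* z + C* u`, `y = B* z`. -/
def dual (sys : StateSystem U Z Y) : StateSystem Y Z U where
  A := sys.A†
  B := sys.C.adjoint
  C := sys.B.adjoint

/-- The bounded, boundedly invertible `D` carries the first system to the second one:
`A' = D A D⁻¹` (with equality of domains), `B' = D B` and `C' = C D⁻¹`. -/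
def IsIsomorphismTo (sys sys' : StateSystem U Z Y) (D : Z ≃L[ℂ] Z) : Prop :=
  (∀ z w : Z, (z, w) ∈ sys.A.graph ↔ (D z, D w) ∈ sys'.A.graph) ∧
  (D : Z →L[ℂ] Z).comp sys.B = sys'.B ∧
  sys'.C.comp (D : Z →L[ℂ] Z) = sys.C

/-- The state at time `t` (mild solution) for the initial state `z₀` and the input `u`, where `T` is
the semigroup generated by the state operator. -/
def state (sys : StateSystem U Z Y) (T : C0Semigroup Z) (z₀ : Z) (u : ℝ → U) (t : ℝ) : Z :=
  T.op t z₀ + ∫ τ in (0 : ℝ)..t, T.op (t - τ) (sys.B (u τ))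

/-- Internal impedance passivity of a well-posed system with semigroup `T`: along all mild solutions
with square integrable input, the storage `½‖z‖²` satisfies the dissipation inequality with supply
rate `½ (⟨u, y⟩ + ⟨y, u⟩) = Re ⟨u, y⟩`. -/
def IsInternallyImpedancePassive (sys : StateSystem U Z U) (T : C0Semigroup Z) : Prop :=
  T.HasGenerator sys.A ∧
  ∀ (z₀ : Z) (t : ℝ) (u : ℝ → U), 0 ≤ t → MemLp u 2 (volume.restrict (Set.Icc 0 t)) →
    (1 / 2 : ℝ) * ‖sys.state T z₀ u t‖ ^ 2 ≤ (1 / 2 : ℝ) * ‖z₀‖ ^ 2 +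
      ∫ τ in (0 : ℝ)..t, (inner ℂ (u τ) (sys.C (sys.state T z₀ u τ))).re

end StateSystem

/-! ### Linear time-and-space-invariant systems -/

/-- A linear time-and-space-invariant system with input space `L₂(ℝ^s, ℂ^m)`, state space
`L₂(ℝ^s, ℂ^n)` and output space `L₂(ℝ^s, ℂ^p)`: the operators are translation invariant, `A` is
densely defined, and the Fourier symbols are continuous. -/
structure System (s m n p : ℕ) extends StateSystem (L2 s m) (L2 s n) (L2 s p) where
  dense_domain : Dense (A.domain : Set (L2 s n))
  invariant_A : IsTranslationInvariant A
  invariant_B : IsTranslationInvariant (everywhere B)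
  invariant_C : IsTranslationInvariant (everywhere C)
  /-- The Fourier symbol of `A`. -/
  symA : Space s → Matrix (Fin n) (Fin n) ℂ
  /-- The Fourier symbol of `B`. -/
  symB : Space s → Matrix (Fin n) (Fin m) ℂ
  /-- The Fourier symbol of `C`. -/
  symC : Space s → Matrix (Fin p) (Fin n) ℂ
  continuous_symA : Continuous symA
  continuous_symB : Continuous symB
  continuous_symC : Continuous symC
  hasSymbol_A : HasFourierSymbol A symA
  hasSymbol_B : HasFourierSymbol (everywhere B) symB
  hasSymbol_C : HasFourierSymbol (everywhere C) symC

/-- The controllability matrix `[B, A B, …, A^(n-1) B]`. -/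
def controllabilityMatrix {n m : ℕ} (A : Matrix (Fin n) (Fin n) ℂ) (B : Matrix (Fin n) (Fin m) ℂ) :
    Matrix (Fin n) (Fin n × Fin m) ℂ :=
  Matrix.of fun i kj => (A ^ (kj.1 : ℕ) * B) i kj.2

/-- The observability matrix, with blocks `C, C A, …, C A^(n-1)` on top of each other. -/
def observabilityMatrix {n p : ℕ} (A : Matrix (Fin n) (Fin n) ℂ) (C : Matrix (Fin p) (Fin n) ℂ) :
    Matrix (Fin n × Fin p) (Fin n) ℂ :=
  Matrix.of fun ki j => (C * A ^ (ki.1 : ℕ)) ki.2 j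

/-- The finite-dimensional system `(A, B, C)` is minimal, i.e. controllable and observable. -/
def IsMinimal {n m p : ℕ} (A : Matrix (Fin n) (Fin n) ℂ) (B : Matrix (Fin n) (Fin m) ℂ)
    (C : Matrix (Fin p) (Fin n) ℂ) : Prop :=
  (controllabilityMatrix A B).rank = n ∧ (observabilityMatrix A C).rank = n

/-- The reciprocity equations `A* S = S A`, `C* = S B`. -/
def ReciprocityEquations {n m : ℕ} (A : Matrix (Fin n) (Fin n) ℂ) (B : Matrix (Fin n) (Fin m) ℂ)
    (C : Matrix (Fin m) (Fin n) ℂ) (S : Matrix (Fin n) (Fin n) ℂ) : Prop :=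
  Aᴴ * S = S * A ∧ Cᴴ = S * B

/-- The passivity conditions `A* Q + Q A ≤ 0`, `C* = Q B`. -/
def PassivityConditions {n m : ℕ} (A : Matrix (Fin n) (Fin n) ℂ) (B : Matrix (Fin n) (Fin m) ℂ)
    (C : Matrix (Fin m) (Fin n) ℂ) (Q : Matrix (Fin n) (Fin n) ℂ) : Prop :=
  (-(Aᴴ * Q + Q * A)).PosSemidef ∧ Cᴴ = Q * B

/-- The operator is self-adjoint (in particular densely defined) and nonpositive. -/
def IsNonpositive {Z : Type*} [NormedAddCommGroup Z] [InnerProductSpace ℂ Z] [CompleteSpace Z]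
    (A : Z →ₗ.[ℂ] Z) : Prop :=
  Dense (A.domain : Set Z) ∧ A† = A ∧ ∀ z : A.domain, (inner ℂ (A z) (z : Z)).re ≤ 0

namespace System

variable {s m n p : ℕ}

/-- The impulse response at time `t`: the translation invariant operator (on its natural domain)
with Fourier symbol `ω ↦ C_ω exp (A_ω t) B_ω`. -/
def impulseResponse (sys : System s m n p) (t : ℝ) : L2 s m →ₗ.[ℂ] L2 s p :=
  multiplier fun ω => sys.symC ω * NormedSpace.exp (t • sys.symA ω) * sys.symB ω

/-- Reciprocity: the impulse response is self-adjoint at all times `t ≥ 0`. -/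
def IsReciprocal (sys : System s m n m) : Prop :=
  ∀ t : ℝ, 0 ≤ t → Dense ((sys.impulseResponse t).domain : Set (L2 s m)) ∧
    (sys.impulseResponse t)† = sys.impulseResponse t

/-- Weak impedance passivity: every frequency system is passive. -/
def IsWeaklyImpedancePassive (sys : System s m n m) : Prop :=
  ∀ ω : Space s, ∃ Q : Matrix (Fin n) (Fin n) ℂ,
    Q.PosSemidef ∧ PassivityConditions (sys.symA ω) (sys.symB ω) (sys.symC ω) Q

/-- Self-duality: the system is isomorphic to its dual system, through a translation invariant
state-space isomorphism that is bounded with bounded inverse. -/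
def IsSelfDual (sys : System s m n m) : Prop :=
  ∃ D : L2 s n ≃L[ℂ] L2 s n,
    IsTranslationInvariant (everywhere (D : L2 s n →L[ℂ] L2 s n)) ∧
    sys.toStateSystem.IsIsomorphismTo sys.toStateSystem.dual D

end System

/-! ### Partition of the state space -/

/-- The inclusion of the first factor in `L₂(ℝ^s, ℂ^n) = L₂(ℝ^s, ℂ^n₁) × L₂(ℝ^s, ℂ^n₂)`, where
`n₁ + n₂ = n`: pointwise, the vector is extended by zero in the last `n₂` components. -/
def incl₁ (s : ℕ) {n n₁ n₂ : ℕ} (h : n₁ + n₂ = n) : L2 s n₁ →L[ℂ] L2 s n :=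
  ContinuousLinearMap.compLpL 2 volume (LinearMap.toContinuousLinearMap
    { toFun := fun v => WithLp.toLp 2 fun i => Fin.append (WithLp.ofLp v) (0 : Fin n₂ → ℂ)
        (Fin.cast h.symm i)
      map_add' := fun v w => by
        ext i
        obtain ⟨j, rfl⟩ := (finCongr h).surjective i
        refine Fin.addCases (fun k => ?_) (fun k => ?_) j <;> simp
      map_smul' := fun c v => by
        ext i
        obtain ⟨j, rfl⟩ := (finCongr h).surjective i
        refine Fin.addCases (fun k => ?_) (fun k => ?_) j <;> simp } :
    EuclideanSpace ℂ (Fin n₁) →L[ℂ] EuclideanSpace ℂ (Fin n))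

/-- The inclusion of the second factor: extension by zero in the first `n₁` components. -/
def incl₂ (s : ℕ) {n n₁ n₂ : ℕ} (h : n₁ + n₂ = n) : L2 s n₂ →L[ℂ] L2 s n :=
  ContinuousLinearMap.compLpL 2 volume (LinearMap.toContinuousLinearMap
    { toFun := fun v => WithLp.toLp 2 fun i => Fin.append (0 : Fin n₁ → ℂ) (WithLp.ofLp v)
        (Fin.cast h.symm i)
      map_add' := fun v w => by
        ext i
        obtain ⟨j, rfl⟩ := (finCongr h).surjective i
        refine Fin.addCases (fun k => ?_) (fun k => ?_) j <;> simp
      map_smul' := fun c v => by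
        ext i
        obtain ⟨j, rfl⟩ := (finCongr h).surjective i
        refine Fin.addCases (fun k => ?_) (fun k => ?_) j <;> simp } :
    EuclideanSpace ℂ (Fin n₂) →L[ℂ] EuclideanSpace ℂ (Fin n))

/-- The projection to the first factor: pointwise, the first `n₁` components. -/
def proj₁ (s : ℕ) {n n₁ n₂ : ℕ} (h : n₁ + n₂ = n) : L2 s n →L[ℂ] L2 s n₁ :=
  ContinuousLinearMap.compLpL 2 volume (LinearMap.toContinuousLinearMap
    { toFun := fun v => WithLp.toLp 2 fun i => v (Fin.cast h (Fin.castAdd n₂ i))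
      map_add' := fun _ _ => rfl
      map_smul' := fun _ _ => rfl } :
    EuclideanSpace ℂ (Fin n) →L[ℂ] EuclideanSpace ℂ (Fin n₁))

/-- The projection to the second factor: pointwise, the last `n₂` components. -/
def proj₂ (s : ℕ) {n n₁ n₂ : ℕ} (h : n₁ + n₂ = n) : L2 s n →L[ℂ] L2 s n₂ :=
  ContinuousLinearMap.compLpL 2 volume (LinearMap.toContinuousLinearMap
    { toFun := fun v => WithLp.toLp 2 fun i => v (Fin.cast h (Fin.natAdd n₁ i))
      map_add' := fun _ _ => rfl
      map_smul' := fun _ _ => rfl } :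
    EuclideanSpace ℂ (Fin n) →L[ℂ] EuclideanSpace ℂ (Fin n₂))

/-- The operator matrix `[A₁₁, A₁₂; A₂₁, A₂₂]` on `L₂(ℝ^s, ℂ^n)`, with its natural domain
`(D(A₁₁) ∩ D(A₂₁)) × (D(A₁₂) ∩ D(A₂₂))`. -/
def block {s n n₁ n₂ : ℕ} (h : n₁ + n₂ = n)
    (A₁₁ : L2 s n₁ →ₗ.[ℂ] L2 s n₁) (A₁₂ : L2 s n₂ →ₗ.[ℂ] L2 s n₁)
    (A₂₁ : L2 s n₁ →ₗ.[ℂ] L2 s n₂) (A₂₂ : L2 s n₂ →ₗ.[ℂ] L2 s n₂) : L2 s n →ₗ.[ℂ] L2 s n where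
  domain := (A₁₁.domain ⊓ A₂₁.domain).comap (proj₁ s h : L2 s n →ₗ[ℂ] L2 s n₁) ⊓
    (A₁₂.domain ⊓ A₂₂.domain).comap (proj₂ s h : L2 s n →ₗ[ℂ] L2 s n₂)
  toFun :=
    { toFun := fun z =>
        incl₁ s h (A₁₁ ⟨proj₁ s h z, z.2.1.1⟩ + A₁₂ ⟨proj₂ s h z, z.2.2.1⟩) +
        incl₂ s h (A₂₁ ⟨proj₁ s h z, z.2.1.2⟩ + A₂₂ ⟨proj₂ s h z, z.2.2.2⟩)
      map_add' := fun z w => by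
        have e₁₁ := A₁₁.map_add ⟨proj₁ s h z, z.2.1.1⟩ ⟨proj₁ s h w, w.2.1.1⟩
        have e₂₁ := A₂₁.map_add ⟨proj₁ s h z, z.2.1.2⟩ ⟨proj₁ s h w, w.2.1.2⟩
        have e₁₂ := A₁₂.map_add ⟨proj₂ s h z, z.2.2.1⟩ ⟨proj₂ s h w, w.2.2.1⟩
        have e₂₂ := A₂₂.map_add ⟨proj₂ s h z, z.2.2.2⟩ ⟨proj₂ s h w, w.2.2.2⟩
        simp only [AddMemClass.mk_add_mk] at e₁₁ e₂₁ e₁₂ e₂₂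
        simp only [Submodule.coe_add, map_add, e₁₁, e₂₁, e₁₂, e₂₂]
        abel
      map_smul' := fun c z => by
        have e₁₁ := A₁₁.map_smul c ⟨proj₁ s h z, z.2.1.1⟩
        have e₂₁ := A₂₁.map_smul c ⟨proj₁ s h z, z.2.1.2⟩
        have e₁₂ := A₁₂.map_smul c ⟨proj₂ s h z, z.2.2.1⟩
        have e₂₂ := A₂₂.map_smul c ⟨proj₂ s h z, z.2.2.2⟩
        simp only [SetLike.mk_smul_mk] at e₁₁ e₂₁ e₁₂ e₂₂
        simp only [Submodule.coe_smul, map_smul, e₁₁, e₂₁, e₁₂, e₂₂, map_add, smul_add,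
          RingHom.id_apply] }

end LTSI

end

/-! The relation `Q = S Q⁻¹ S` says that `E = S⁻¹ Q` is an involution at every frequency. Since
`ℝ^s` contracts radially to the origin, a continuous family of involutions has a continuous frame
`V` of eigenvectors, with one signature matrix `σ = diag(1, …, 1, -1, …, -1)` for all frequencies
(`exists_continuous_frame`). Both `M = V* Q V` and `M σ = V* S V` are Hermitian, so `M` commutes
with `σ`, and so does its square root. Hence `H = M^(1/2) V⁻¹` is continuous with `H* H = Q` and `H*
σ H = S` (`exists_normalForm`).

Taking `H` as a change of state coordinates at each frequency replaces the symbols by `a = H A H⁻¹`,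
`b = H B` and `b*` (`normalForm_symbols`). The passivity inequality becomes `a + a* ≤ 0`, the
reciprocity equation becomes `a* σ = σ a`, and comparing `C* = Q B` with `C* = S B` gives `σ b = b`.
Neither `H` nor `H⁻¹` need be bounded, so the new system need not be similar to the old one on `L₂`.
The symbol of the impulse response is nevertheless unchanged, and `b` is bounded because `b* b = C
S⁻¹ Q B` is.

The rest is operator theory of multipliers with continuous symbols on natural domains. Frequency
cut-offs map `L₂` into every such domain, which yields density, the adjoint (`multiplier_adjoint`)
and the closure of the block matrix (`closure_block`). A dissipative symbol generates the
contraction semigroup with symbol `exp (t a)` (`semigroup_hasGenerator`). Contractivity together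
with `C = B*` gives internal passivity (`isInternallyImpedancePassive_of_isContractive`). The matrix
`σ` itself is the self-duality, and reading `a* σ = σ a` and `σ b = b` by blocks gives the
partition. -/

noncomputable section

namespace LTSI
-- Bounded matrix multiplication on `L₂` and its relation to the Fourier transform.
section Multipliers
open scoped Matrix.Norms.L2Operator

variable {s n m p : ℕ}

/-! ### Multiplication operators -/

/-- Pointwise product of a matrix-valued and a vector-valued function. -/
def matMul (b : Space s → Matrix (Fin m) (Fin n) ℂ) (f : Space s → EuclideanSpace ℂ (Fin n)) :
    Space s → EuclideanSpace ℂ (Fin m) :=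
  fun ξ => WithLp.toLp 2 (b ξ *ᵥ WithLp.ofLp (f ξ))

lemma aestronglyMeasurable_matMul {b : Space s → Matrix (Fin m) (Fin n) ℂ} (hb : Continuous b)
    {f : Space s → EuclideanSpace ℂ (Fin n)} (hf : AEStronglyMeasurable f volume) :
    AEStronglyMeasurable (matMul b f) volume := by
  have hc : Continuous fun p : Matrix (Fin m) (Fin n) ℂ × EuclideanSpace ℂ (Fin n) =>
      (WithLp.toLp 2 (p.1 *ᵥ WithLp.ofLp p.2) : EuclideanSpace ℂ (Fin m)) := by
    fun_prop
  exact hc.comp_aestronglyMeasurable (hb.aestronglyMeasurable.prodMk hf)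

lemma norm_matMul_le (b : Space s → Matrix (Fin m) (Fin n) ℂ)
    (f : Space s → EuclideanSpace ℂ (Fin n)) (ξ : Space s) :
    ‖matMul b f ξ‖ ≤ ‖b ξ‖ * ‖f ξ‖ :=
  Matrix.l2_opNorm_mulVec (b ξ) (f ξ)

lemma memLp_matMul {b : Space s → Matrix (Fin m) (Fin n) ℂ} (hb : Continuous b) {C : ℝ}
    (hC : ∀ ξ, ‖b ξ‖ ≤ C) {f : Space s → EuclideanSpace ℂ (Fin n)} (hf : MemLp f 2 volume) :
    MemLp (matMul b f) 2 volume :=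
  hf.of_le_mul (aestronglyMeasurable_matMul hb hf.1) (.of_forall fun ξ =>
    (norm_matMul_le b f ξ).trans (mul_le_mul_of_nonneg_right (hC ξ) (norm_nonneg _)))

/-- Multiplication by a bounded continuous matrix function. -/
def matMulL (b : Space s → Matrix (Fin m) (Fin n) ℂ) (hb : Continuous b)
    (C : ℝ) (hC : ∀ ξ, ‖b ξ‖ ≤ C) : L2 s n →L[ℂ] L2 s m :=
  LinearMap.mkContinuous
    { toFun := fun f => (memLp_matMul hb hC (Lp.memLp f)).toLp _
      map_add' := fun f g => by
        rw [← MemLp.toLp_add]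
        refine MemLp.toLp_congr _ _ ?_
        filter_upwards [Lp.coeFn_add f g] with ξ hξ
        simp only [matMul, hξ, Pi.add_apply, WithLp.ofLp_add, Matrix.mulVec_add, WithLp.toLp_add]
      map_smul' := fun c f => by
        rw [RingHom.id_apply, ← MemLp.toLp_const_smul]
        refine MemLp.toLp_congr _ _ ?_
        filter_upwards [Lp.coeFn_smul c f] with ξ hξ
        simp only [matMul, hξ, Pi.smul_apply, WithLp.ofLp_smul, Matrix.mulVec_smul,
          WithLp.toLp_smul] } C
    fun f => by
      refine Lp.norm_le_mul_norm_of_ae_le_mul ?_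
      filter_upwards [MemLp.coeFn_toLp (memLp_matMul hb hC (Lp.memLp f))] with ξ hξ
      change ‖((memLp_matMul hb hC (Lp.memLp f)).toLp _ : L2 s m) ξ‖ ≤ _
      rw [hξ]
      exact (norm_matMul_le b f ξ).trans (mul_le_mul_of_nonneg_right (hC ξ) (norm_nonneg _))

lemma coeFn_matMulL {b : Space s → Matrix (Fin m) (Fin n) ℂ} (hb : Continuous b)
    {C : ℝ} (hC : ∀ ξ, ‖b ξ‖ ≤ C) (f : L2 s n) :
    (matMulL b hb C hC f : Space s → _) =ᵐ[volume] matMul b f :=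
  MemLp.coeFn_toLp (memLp_matMul hb hC (Lp.memLp f))

/-! ### The Fourier transform, translations and constant matrices -/

/-- The character `ξ ↦ exp (2πi⟨ξ, x⟩)` as a scalar matrix function. -/
def charMat (n : ℕ) (x : Space s) (ξ : Space s) : Matrix (Fin n) (Fin n) ℂ :=
  ((Real.fourierChar (inner ℝ x ξ) : Circle) : ℂ) • (1 : Matrix (Fin n) (Fin n) ℂ)

lemma continuous_charMat (x : Space s) : Continuous (charMat n x) := by
  unfold charMat
  have : Continuous fun ξ : Space s => ((Real.fourierChar (inner ℝ x ξ) : Circle) : ℂ) :=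
    continuous_subtype_val.comp (Real.continuous_fourierChar.comp (by fun_prop))
  exact this.smul continuous_const

lemma norm_charMat_le (x ξ : Space s) : ‖charMat n x ξ‖ ≤ ‖(1 : Matrix (Fin n) (Fin n) ℂ)‖ := by
  rw [charMat, norm_smul, Circle.norm_coe, one_mul]

lemma matMul_charMat (x : Space s) (f : Space s → EuclideanSpace ℂ (Fin n)) (ξ : Space s) :
    matMul (charMat n x) f ξ = ((Real.fourierChar (inner ℝ x ξ) : Circle) : ℂ) • f ξ := by
  simp [matMul, charMat, Matrix.smul_mulVec]

/-- Schwartz functions are dense in `L₂`, and on them the Fourier transform is an honest integral.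
Identities between continuous operators are therefore checked there. -/
lemma schwartz_toLp_induction {P : L2 s n → Prop} (hP : IsClosed {f | P f})
    (h : ∀ φ : SchwartzMap (Space s) (EuclideanSpace ℂ (Fin n)), P (φ.toLp 2 volume))
    (f : L2 s n) : P f :=
  DenseRange.induction_on (p := P)
    (SchwartzMap.denseRange_toLpCLM (p := 2) (μ := volume) ENNReal.ofNat_ne_top) f hP h

lemma fourier_toLp_coeFn (φ : SchwartzMap (Space s) (EuclideanSpace ℂ (Fin n))) :
    ((𝓕 (φ.toLp 2 volume : L2 s n) : L2 s n) : Space s → _) =ᵐ[volume]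
      𝓕 (φ : Space s → EuclideanSpace ℂ (Fin n)) := by
  rw [SchwartzMap.toLp_fourier_eq, ← SchwartzMap.fourier_coe]
  exact SchwartzMap.coeFn_toLp _ _ _

lemma fourier_eq_of_toLp_ae {φ : SchwartzMap (Space s) (EuclideanSpace ℂ (Fin n))} {f : L2 s n}
    (h : (f : Space s → _) =ᵐ[volume] φ) :
    ((𝓕 f : L2 s n) : Space s → _) =ᵐ[volume] 𝓕 (φ : Space s → EuclideanSpace ℂ (Fin n)) := by
  have : f = φ.toLp 2 volume := Lp.ext (h.trans (SchwartzMap.coeFn_toLp _ _ _).symm)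
  rw [this]
  exact fourier_toLp_coeFn φ

lemma continuous_translate (x : Space s) : Continuous (translate x : L2 s n → L2 s n) :=
  (Lp.isometry_compMeasurePreserving _).continuous

/-- A shift becomes a modulation by a character. The pointwise formula is first phrased as an
identity of bounded operators, which is a closed condition on `f`. -/
lemma fourier_translate (x : Space s) (f : L2 s n) :
    ((𝓕 (translate x f) : L2 s n) : Space s → _) =ᵐ[volume] fun ξ =>
      ((Real.fourierChar (inner ℝ x ξ) : Circle) : ℂ) • (𝓕 f : L2 s n) ξ := by
  have key : (𝓕 (translate x f) : L2 s n) =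
      matMulL (charMat n x) (continuous_charMat x) _ (norm_charMat_le x) (𝓕 f) := by
    refine schwartz_toLp_induction (P := fun f => (𝓕 (translate x f) : L2 s n) =
      matMulL (charMat n x) (continuous_charMat x) _ (norm_charMat_le x) (𝓕 f)) ?_ ?_ f
    · refine isClosed_eq ?_ ?_
      · exact (Lp.fourierTransformₗᵢ _ _).continuous.comp (continuous_translate x)
      · exact (ContinuousLinearMap.continuous _).comp (Lp.fourierTransformₗᵢ _ _).continuous
    · intro φ
      let ψ : SchwartzMap (Space s) (EuclideanSpace ℂ (Fin n)) :=
        SchwartzMap.compSubConstCLM ℂ (-x) φ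
      have hψ : (ψ : Space s → _) = fun y => φ (y + x) := by
        ext y; simp [ψ]
      refine Lp.ext ?_
      have h1 : (translate x (φ.toLp 2 volume : L2 s n) : Space s → _) =ᵐ[volume] ψ := by
        rw [hψ]
        refine (Lp.coeFn_compMeasurePreserving _ (measurePreserving_add_right volume x)).trans ?_
        exact (measurePreserving_add_right volume x).quasiMeasurePreserving.ae_eq_comp
          (SchwartzMap.coeFn_toLp φ 2 volume)
      refine (fourier_eq_of_toLp_ae h1).trans ?_
      filter_upwards [coeFn_matMulL (continuous_charMat x) (norm_charMat_le x)
        (𝓕 (φ.toLp 2 volume : L2 s n)), fourier_toLp_coeFn φ] with ξ h2 h3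
      rw [h2, matMul_charMat, h3, hψ]
      exact congrFun (VectorFourier.fourierIntegral_comp_add_right Real.fourierChar volume
        (innerₗ (Space s)) φ x) ξ
  rw [key]
  filter_upwards [coeFn_matMulL (continuous_charMat x) (norm_charMat_le x) (𝓕 f)] with ξ h2
  rw [h2, matMul_charMat]

/-- A constant linear map passes through the Fourier integral. This moves the inclusions and
projections of the state-space partition to the frequency side. -/
lemma fourier_compLpL (L : EuclideanSpace ℂ (Fin n) →L[ℂ] EuclideanSpace ℂ (Fin m)) (f : L2 s n) :
    (𝓕 (L.compLpL 2 volume f : L2 s m) : L2 s m) = L.compLpL 2 volume (𝓕 f : L2 s n) := by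
  refine schwartz_toLp_induction (P := fun f =>
    (𝓕 (L.compLpL 2 volume f : L2 s m) : L2 s m) = L.compLpL 2 volume (𝓕 f : L2 s n)) ?_ ?_ f
  · refine isClosed_eq ?_ ?_
    · exact (Lp.fourierTransformₗᵢ _ _).continuous.comp (ContinuousLinearMap.continuous _)
    · exact (ContinuousLinearMap.continuous _).comp (Lp.fourierTransformₗᵢ _ _).continuous
  · intro φ
    let ψ : SchwartzMap (Space s) (EuclideanSpace ℂ (Fin m)) :=
      SchwartzMap.postcompCLM L φ
    have hψ : (ψ : Space s → _) = fun y => L (φ y) := rfl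
    refine Lp.ext ?_
    have h1 : (L.compLpL 2 volume (φ.toLp 2 volume : L2 s n) : Space s → _) =ᵐ[volume] ψ := by
      filter_upwards [L.coeFn_compLpL (φ.toLp 2 volume : L2 s n), SchwartzMap.coeFn_toLp φ 2 volume]
        with y h2 h3
      rw [h2, h3, hψ]
    refine (fourier_eq_of_toLp_ae h1).trans ?_
    filter_upwards [L.coeFn_compLpL (𝓕 (φ.toLp 2 volume : L2 s n)), fourier_toLp_coeFn φ] with
      ξ h2 h3
    rw [h2, h3, hψ, Real.fourier_eq, Real.fourier_eq, ← L.integral_comp_comm]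
    · simp [Circle.smul_def]
    · exact (Real.fourierIntegral_convergent_iff ξ).2 φ.integrable

end Multipliers
-- Multipliers on natural domains, and frequency cut-offs.
section Adjoints
open scoped Matrix.Norms.L2Operator

variable {s n m p : ℕ}

lemma inner_toLp_mulVec (a : Matrix (Fin m) (Fin n) ℂ) (x : EuclideanSpace ℂ (Fin n))
    (y : EuclideanSpace ℂ (Fin m)) :
    inner ℂ y (WithLp.toLp 2 (a *ᵥ WithLp.ofLp x)) =
      inner ℂ (WithLp.toLp 2 (aᴴ *ᵥ WithLp.ofLp y)) x := by
  simp only [EuclideanSpace.inner_eq_star_dotProduct, Matrix.star_mulVec,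
    Matrix.conjTranspose_conjTranspose]
  rw [dotProduct_comm, Matrix.dotProduct_mulVec, dotProduct_comm]

lemma inner_matMulL {b : Space s → Matrix (Fin m) (Fin n) ℂ} (hb : Continuous b) {C C' : ℝ}
    (hC : ∀ ξ, ‖b ξ‖ ≤ C) (hC' : ∀ ξ, ‖(b ξ)ᴴ‖ ≤ C') (f : L2 s n) (g : L2 s m) :
    inner ℂ g (matMulL b hb C hC f) =
      inner ℂ (matMulL (fun ξ => (b ξ)ᴴ) hb.matrix_conjTranspose C' hC' g) f := by
  rw [L2.inner_def, L2.inner_def]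
  refine integral_congr_ae ?_
  filter_upwards [coeFn_matMulL hb hC f, coeFn_matMulL hb.matrix_conjTranspose hC' g] with ξ h1 h2
  rw [h1, h2]
  exact inner_toLp_mulVec _ _ _

/-! ### Multipliers -/

/-- The symbol in the frequency variable of Mathlib's Fourier transform. -/
def rescale (a : Space s → Matrix (Fin m) (Fin n) ℂ) : Space s → Matrix (Fin m) (Fin n) ℂ :=
  fun ξ => a ((2 * Real.pi) • ξ)

lemma continuous_rescale {a : Space s → Matrix (Fin m) (Fin n) ℂ} (ha : Continuous a) :
    Continuous (rescale a) :=
  ha.comp (continuous_const_smul _)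

lemma symbolMul_eq (a : Space s → Matrix (Fin m) (Fin n) ℂ) (f : L2 s n) :
    symbolMul a f = matMul (rescale a) (𝓕 f : L2 s n) := rfl

lemma ext_fourier {f g : L2 s n}
    (h : ((𝓕 f : L2 s n) : Space s → _) =ᵐ[volume] (𝓕 g : L2 s n)) : f = g :=
  (Lp.fourierTransformₗᵢ (Space s) (EuclideanSpace ℂ (Fin n))).injective (Lp.ext h)

lemma inner_eq_inner_fourier (f g : L2 s n) :
    inner ℂ f g = inner ℂ (𝓕 f : L2 s n) (𝓕 g : L2 s n) :=
  (Lp.inner_fourier_eq f g).symm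

lemma mem_multiplier_domain {a : Space s → Matrix (Fin m) (Fin n) ℂ} {f : L2 s n} :
    f ∈ (multiplier a).domain ↔ MemLp (symbolMul a f) 2 volume := Iff.rfl

lemma fourier_multiplier (a : Space s → Matrix (Fin m) (Fin n) ℂ) (f : (multiplier a).domain) :
    ((𝓕 (multiplier a f) : L2 s m) : Space s → _) =ᵐ[volume] symbolMul a f := by
  have h : (𝓕 (multiplier a f) : L2 s m) = MemLp.toLp (symbolMul a (f : L2 s n)) f.2 :=
    FourierTransform.fourier_fourierInv_eq _
  rw [h]
  exact MemLp.coeFn_toLp _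

lemma hasFourierSymbol_multiplier (a : Space s → Matrix (Fin m) (Fin n) ℂ) :
    HasFourierSymbol (multiplier a) a :=
  fourier_multiplier a

/-- The domain condition disappears because the domain is maximal: if the product agrees a.e. with
the transform of an `L₂` function, it is itself in `L₂`. Equalities of unbounded operators thus
reduce to a.e. identities. -/
lemma mem_graph_multiplier {a : Space s → Matrix (Fin m) (Fin n) ℂ} {f : L2 s n} {g : L2 s m} :
    (f, g) ∈ (multiplier a).graph ↔
      ((𝓕 g : L2 s m) : Space s → _) =ᵐ[volume] symbolMul a f := by
  rw [LinearPMap.mem_graph_iff]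
  constructor
  · rintro ⟨f', rfl, rfl⟩
    exact fourier_multiplier a f'
  · intro h
    have hf : f ∈ (multiplier a).domain :=
      mem_multiplier_domain.2 ((memLp_congr_ae h).1 (Lp.memLp _))
    exact ⟨⟨f, hf⟩, rfl, ext_fourier ((fourier_multiplier a ⟨f, hf⟩).trans h.symm)⟩

lemma symbolMul_translate (a : Space s → Matrix (Fin m) (Fin n) ℂ) (x : Space s) (f : L2 s n) :
    symbolMul a (translate x f) =ᵐ[volume] fun ξ =>
      ((Real.fourierChar (inner ℝ x ξ) : Circle) : ℂ) • symbolMul a f ξ := by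
  filter_upwards [fourier_translate x f] with ξ h
  simp only [symbolMul, h, WithLp.ofLp_smul, Matrix.mulVec_smul, WithLp.toLp_smul]

/-- Translations act in frequency as scalar characters, which commute with every matrix symbol. -/
lemma isTranslationInvariant_multiplier (a : Space s → Matrix (Fin m) (Fin n) ℂ) :
    IsTranslationInvariant (multiplier a) := by
  intro x f
  have h : (translate x (f : L2 s n), translate x (multiplier a f)) ∈ (multiplier a).graph := by
    rw [mem_graph_multiplier]
    filter_upwards [fourier_translate x (multiplier a f), symbolMul_translate a x (f : L2 s n),
      fourier_multiplier a f] with ξ h1 h2 h3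
    rw [h1, h2, h3]
  obtain ⟨f', h1, h2⟩ := (LinearPMap.mem_graph_iff _).1 h
  have h3 : translate x (f : L2 s n) ∈ (multiplier a).domain := by
    have := f'.2
    rwa [h1] at this
  exact ⟨h3, (congrArg (multiplier a) (Subtype.ext h1.symm)).trans h2⟩

/-- The bounded translation invariant operator with a bounded continuous symbol. -/
def boundedMultiplier (b : Space s → Matrix (Fin m) (Fin n) ℂ) (hb : Continuous b)
    (C : ℝ) (hC : ∀ ξ, ‖b ξ‖ ≤ C) : L2 s n →L[ℂ] L2 s m :=
  ((Lp.fourierTransformₗᵢ (Space s) (EuclideanSpace ℂ (Fin m))).symm.toContinuousLinearEquiv :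
      L2 s m →L[ℂ] L2 s m) ∘L
    matMulL (rescale b) (continuous_rescale hb) C (fun _ => hC _) ∘L
    ((Lp.fourierTransformₗᵢ (Space s) (EuclideanSpace ℂ (Fin n))).toContinuousLinearEquiv :
      L2 s n →L[ℂ] L2 s n)

lemma fourier_boundedMultiplier' {b : Space s → Matrix (Fin m) (Fin n) ℂ} (hb : Continuous b)
    {C : ℝ} (hC : ∀ ξ, ‖b ξ‖ ≤ C) (f : L2 s n) :
    (𝓕 (boundedMultiplier b hb C hC f) : L2 s m) =
      matMulL (rescale b) (continuous_rescale hb) C (fun _ => hC _) (𝓕 f : L2 s n) :=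
  FourierTransform.fourier_fourierInv_eq _

lemma fourier_boundedMultiplier {b : Space s → Matrix (Fin m) (Fin n) ℂ} (hb : Continuous b)
    {C : ℝ} (hC : ∀ ξ, ‖b ξ‖ ≤ C) (f : L2 s n) :
    ((𝓕 (boundedMultiplier b hb C hC f) : L2 s m) : Space s → _) =ᵐ[volume] symbolMul b f := by
  rw [fourier_boundedMultiplier']
  exact coeFn_matMulL _ _ _

lemma mem_graph_everywhere {E F : Type*} [NormedAddCommGroup E] [NormedSpace ℂ E]
    [NormedAddCommGroup F] [NormedSpace ℂ F] (T : E →L[ℂ] F) {x : E} {y : F} :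
    (x, y) ∈ (everywhere T).graph ↔ T x = y := by
  rw [LinearPMap.mem_graph_iff]
  constructor
  · rintro ⟨x', rfl, rfl⟩; rfl
  · rintro rfl
    exact ⟨⟨x, trivial⟩, rfl, rfl⟩

/-- Equality here includes that of the domains, so the symbol need not be known to be bounded: an
everywhere defined operator with symbol `b` already exhausts the natural domain. -/
lemma everywhere_eq_multiplier {b : Space s → Matrix (Fin m) (Fin n) ℂ} {T : L2 s n →L[ℂ] L2 s m}
    (h : ∀ f, ((𝓕 (T f) : L2 s m) : Space s → _) =ᵐ[volume] symbolMul b f) :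
    everywhere T = multiplier b := by
  refine LinearPMap.eq_of_eq_graph (SetLike.ext ?_)
  rintro ⟨f, g⟩
  rw [mem_graph_everywhere, mem_graph_multiplier]
  constructor
  · rintro rfl
    exact h f
  · intro hg
    exact ext_fourier ((h f).trans hg.symm)

lemma everywhere_boundedMultiplier {b : Space s → Matrix (Fin m) (Fin n) ℂ} (hb : Continuous b)
    {C : ℝ} (hC : ∀ ξ, ‖b ξ‖ ≤ C) :
    everywhere (boundedMultiplier b hb C hC) = multiplier b :=
  everywhere_eq_multiplier (fourier_boundedMultiplier hb hC)

lemma symbolMul_boundedMultiplier (a : Space s → Matrix (Fin p) (Fin m) ℂ)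
    {b : Space s → Matrix (Fin m) (Fin n) ℂ} (hb : Continuous b)
    {C : ℝ} (hC : ∀ ξ, ‖b ξ‖ ≤ C) (f : L2 s n) :
    symbolMul a (boundedMultiplier b hb C hC f) =ᵐ[volume] symbolMul (fun ω => a ω * b ω) f := by
  filter_upwards [fourier_boundedMultiplier hb hC f] with ξ h
  simp only [symbolMul, h, Matrix.mulVec_mulVec]

lemma boundedMultiplier_adjoint {b : Space s → Matrix (Fin m) (Fin n) ℂ} (hb : Continuous b)
    {C C' : ℝ} (hC : ∀ ξ, ‖b ξ‖ ≤ C) (hC' : ∀ ξ, ‖(b ξ)ᴴ‖ ≤ C') :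
    (boundedMultiplier b hb C hC).adjoint =
      boundedMultiplier (fun ω => (b ω)ᴴ) hb.matrix_conjTranspose C' hC' := by
  refine ((ContinuousLinearMap.eq_adjoint_iff _ _).2 fun g f => ?_).symm
  rw [inner_eq_inner_fourier, inner_eq_inner_fourier g, fourier_boundedMultiplier',
    fourier_boundedMultiplier', inner_matMulL (continuous_rescale hb) (fun _ => hC _)
      (fun _ => hC' _)]
  rfl

/-! ### Frequency cut-off -/

/-- A continuous cut-off function: `1` on the ball of radius `k`, `0` outside that of radius
`k + 1`. -/
def cutoff (k : ℕ) (ξ : Space s) : ℝ := max 0 (min 1 (k + 1 - ‖ξ‖))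

lemma continuous_cutoff (k : ℕ) : Continuous (cutoff k : Space s → ℝ) := by
  unfold cutoff; fun_prop

lemma cutoff_nonneg (k : ℕ) (ξ : Space s) : 0 ≤ cutoff k ξ := le_max_left _ _

lemma cutoff_le_one (k : ℕ) (ξ : Space s) : cutoff k ξ ≤ 1 :=
  max_le zero_le_one (min_le_left _ _)

lemma cutoff_eq_one {k : ℕ} {ξ : Space s} (h : ‖ξ‖ ≤ k) : cutoff k ξ = 1 := by
  unfold cutoff
  rw [min_eq_left (by linarith), max_eq_right zero_le_one]

lemma cutoff_eq_zero {k : ℕ} {ξ : Space s} (h : k + 1 ≤ ‖ξ‖) : cutoff k ξ = 0 := by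
  unfold cutoff
  exact max_eq_left ((min_le_right _ _).trans (by linarith))

lemma eventually_cutoff_eq_one (ξ : Space s) : ∀ᶠ k : ℕ in atTop, cutoff k ξ = 1 := by
  obtain ⟨N, hN⟩ := exists_nat_ge ‖ξ‖
  filter_upwards [eventually_ge_atTop N] with k hk
  exact cutoff_eq_one (hN.trans (by exact_mod_cast hk))

lemma continuous_cutoff_smul {a : Space s → Matrix (Fin m) (Fin n) ℂ} (ha : Continuous a) (k : ℕ) :
    Continuous fun ω => (cutoff k ω : ℂ) • a ω :=
  (Complex.continuous_ofReal.comp (continuous_cutoff k)).smul ha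

lemma exists_bound_cutoff_smul {a : Space s → Matrix (Fin m) (Fin n) ℂ} (ha : Continuous a)
    (k : ℕ) : ∃ C, ∀ ω, ‖(cutoff k ω : ℂ) • a ω‖ ≤ C := by
  obtain ⟨C, hC⟩ := (isCompact_closedBall (0 : Space s) (k + 1)).exists_bound_of_continuousOn
    ha.continuousOn
  have hC0 : 0 ≤ C := (norm_nonneg _).trans (hC 0 (by simp; positivity))
  refine ⟨C, fun ω => ?_⟩
  rcases le_or_gt ‖ω‖ (k + 1) with h | h
  · rw [norm_smul, Complex.norm_real, Real.norm_of_nonneg (cutoff_nonneg _ _)]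
    exact (mul_le_of_le_one_left (norm_nonneg _) (cutoff_le_one _ _)).trans
      (hC ω (by simpa using h))
  · rw [cutoff_eq_zero h.le]
    simpa using hC0

/-- The frequency cut-off operator. -/
def cutoffOp (s n k : ℕ) : L2 s n →L[ℂ] L2 s n :=
  boundedMultiplier (fun ω => (cutoff k ω : ℂ) • (1 : Matrix (Fin n) (Fin n) ℂ))
    (continuous_cutoff_smul continuous_const k)
    (exists_bound_cutoff_smul continuous_const k).choose
    (exists_bound_cutoff_smul continuous_const k).choose_spec

lemma fourier_cutoffOp (k : ℕ) (f : L2 s n) :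
    ((𝓕 (cutoffOp s n k f) : L2 s n) : Space s → _) =ᵐ[volume] fun ξ =>
      (cutoff k ((2 * Real.pi) • ξ) : ℂ) • (𝓕 f : L2 s n) ξ := by
  filter_upwards [fourier_boundedMultiplier (continuous_cutoff_smul continuous_const k)
    (exists_bound_cutoff_smul continuous_const k).choose_spec f] with ξ h
  rw [cutoffOp, h]
  simp [symbolMul, Matrix.smul_mulVec]

lemma symbolMul_cutoffOp (a : Space s → Matrix (Fin m) (Fin n) ℂ) (k : ℕ) (f : L2 s n) :
    symbolMul a (cutoffOp s n k f) =ᵐ[volume] symbolMul (fun ω => (cutoff k ω : ℂ) • a ω) f := by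
  filter_upwards [fourier_cutoffOp k f] with ξ h
  simp only [symbolMul, h, WithLp.ofLp_smul, Matrix.mulVec_smul, Matrix.smul_mulVec]

/-- A continuous symbol is bounded on the compact support of the cut-off. The range of a cut-off
therefore lies in the domains of all multipliers with continuous symbols at once. -/
lemma cutoffOp_mem_domain {a : Space s → Matrix (Fin m) (Fin n) ℂ} (ha : Continuous a) (k : ℕ)
    (f : L2 s n) : cutoffOp s n k f ∈ (multiplier a).domain := by
  obtain ⟨C, hC⟩ := exists_bound_cutoff_smul ha k
  rw [mem_multiplier_domain, memLp_congr_ae (symbolMul_cutoffOp a k f), symbolMul_eq]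
  exact memLp_matMul (continuous_rescale (continuous_cutoff_smul ha k)) (fun _ => hC _)
    (Lp.memLp _)

lemma multiplier_cutoffOp {a : Space s → Matrix (Fin m) (Fin n) ℂ} (ha : Continuous a) (k : ℕ)
    (f : L2 s n) {C : ℝ} (hC : ∀ ω, ‖(cutoff k ω : ℂ) • a ω‖ ≤ C) :
    multiplier a ⟨cutoffOp s n k f, cutoffOp_mem_domain ha k f⟩ =
      boundedMultiplier _ (continuous_cutoff_smul ha k) C hC f := by
  refine ext_fourier ?_
  exact (fourier_multiplier a _).trans ((symbolMul_cutoffOp a k f).trans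
    (fourier_boundedMultiplier _ hC f).symm)

/-- Dominated convergence in `L₂`. -/
lemma tendsto_L2_of_dominated {ι : Type*} {l : Filter ι} [l.IsCountablyGenerated]
    {F : ι → L2 s n} {f : L2 s n} {G : ι → Space s → EuclideanSpace ℂ (Fin n)}
    {g : Space s → ℝ} (hg : MemLp g 2 volume)
    (hF : ∀ i, (F i : Space s → _) =ᵐ[volume] G i)
    (hbound : ∀ᶠ i in l, ∀ᵐ ξ ∂volume, ‖G i ξ - f ξ‖ ≤ g ξ)
    (hlim : ∀ᵐ ξ ∂volume, Tendsto (fun i => G i ξ) l (𝓝 (f ξ))) :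
    Tendsto F l (𝓝 f) := by
  rw [Lp.tendsto_Lp_iff_tendsto_eLpNorm']
  have key : Tendsto (fun i => ∫⁻ ξ, ‖G i ξ - f ξ‖ₑ ^ (2 : ℝ)) l (𝓝 0) := by
    rw [← lintegral_zero (μ := (volume : Measure (Space s)))]
    refine tendsto_lintegral_filter_of_dominated_convergence' (fun ξ => ‖g ξ‖ₑ ^ (2 : ℝ)) ?_ ?_
      ?_ ?_
    · exact .of_forall fun i => (((Lp.aestronglyMeasurable (F i)).congr (hF i)).sub
        (Lp.aestronglyMeasurable _)).enorm.pow_const _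
    · filter_upwards [hbound] with i hi
      filter_upwards [hi] with ξ h1
      gcongr
      rw [enorm_le_iff_norm_le]
      exact h1.trans (le_abs_self _)
    · have := (lintegral_rpow_enorm_lt_top_of_eLpNorm_lt_top (by norm_num) (by norm_num) hg.2).ne
      simpa using this
    · filter_upwards [hlim] with ξ h
      have h4 := ((h.sub_const (f ξ)).enorm).ennrpow_const (2 : ℝ)
      rwa [sub_self, enorm_zero, ENNReal.zero_rpow_of_pos (by norm_num)] at h4
  have h3 := key.ennrpow_const (1 / 2 : ℝ)
  rw [ENNReal.zero_rpow_of_pos (by norm_num)] at h3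
  refine h3.congr fun i => ?_
  rw [eLpNorm_congr_ae ((hF i).sub (EventuallyEq.refl _ (f : Space s → _))),
    eLpNorm_eq_lintegral_rpow_enorm_toReal (by norm_num) (by norm_num)]
  simp

end Adjoints
-- Adjoints of unbounded multipliers, and flows of dissipative matrices.
section AdjointsAndSemigroups
open scoped Matrix.Norms.L2Operator

variable {s n m p : ℕ}

lemma tendsto_of_fourier {ι : Type*} {l : Filter ι} {F : ι → L2 s n} {f : L2 s n}
    (h : Tendsto (fun i => (𝓕 (F i) : L2 s n)) l (𝓝 (𝓕 f))) : Tendsto F l (𝓝 f) := by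
  exact (Lp.fourierTransformₗᵢ (Space s) (EuclideanSpace ℂ (Fin n))
    ).isometry.isUniformInducing.isInducing.tendsto_nhds_iff.2 h

lemma tendsto_cutoffOp (f : L2 s n) :
    Tendsto (fun k => cutoffOp s n k f) atTop (𝓝 f) := by
  refine tendsto_of_fourier (tendsto_L2_of_dominated (g := fun ξ => ‖(𝓕 f : L2 s n) ξ‖)
    (Lp.memLp _).norm (fun k => fourier_cutoffOp k f) (.of_forall fun k => .of_forall fun ξ => ?_)
    (.of_forall fun ξ => ?_))
  · have h1 : (cutoff k ((2 * Real.pi) • ξ) : ℂ) • (𝓕 f : L2 s n) ξ - (𝓕 f : L2 s n) ξ =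
        ((cutoff k ((2 * Real.pi) • ξ) - 1 : ℝ) : ℂ) • (𝓕 f : L2 s n) ξ := by
      push_cast; rw [sub_smul, one_smul]
    rw [h1, norm_smul, Complex.norm_real, Real.norm_eq_abs]
    refine mul_le_of_le_one_left (norm_nonneg _) (abs_le.2 ⟨?_, ?_⟩)
    · linarith [cutoff_nonneg k ((2 * Real.pi) • ξ)]
    · linarith [cutoff_le_one k ((2 * Real.pi) • ξ)]
  · refine tendsto_const_nhds.congr' ?_
    filter_upwards [eventually_cutoff_eq_one ((2 * Real.pi) • ξ)] with k hk
    rw [hk, Complex.ofReal_one, one_smul]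

lemma dense_multiplier_domain {a : Space s → Matrix (Fin m) (Fin n) ℂ} (ha : Continuous a) :
    Dense ((multiplier a).domain : Set (L2 s n)) := fun f =>
  mem_closure_of_tendsto (tendsto_cutoffOp f) (.of_forall fun k => cutoffOp_mem_domain ha k f)

/-- The adjoint of a multiplier with continuous symbol, with equality of domains. -/
lemma multiplier_adjoint {a : Space s → Matrix (Fin m) (Fin n) ℂ} (ha : Continuous a) :
    (multiplier a)† = multiplier fun ω => (a ω)ᴴ := by
  refine LinearPMap.eq_of_eq_graph (SetLike.ext ?_)
  rintro ⟨g, w⟩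
  rw [LinearPMap.adjoint_graph_eq_graph_adjoint (dense_multiplier_domain ha),
    Submodule.mem_adjoint_iff, mem_graph_multiplier]
  constructor
  · intro h
    -- Testing the adjoint relation on cut-offs of arbitrary functions turns both sides into
    -- adjoints of bounded multipliers. This determines `𝓕 w` wherever the cut-off does not vanish,
    -- and each frequency is reached for large `k`.
    have key : ∀ k : ℕ, ∀ᵐ ξ ∂volume, (cutoff k ((2 * Real.pi) • ξ) : ℂ) • (𝓕 w : L2 s n) ξ =
        (cutoff k ((2 * Real.pi) • ξ) : ℂ) • symbolMul (fun ω => (a ω)ᴴ) g ξ := by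
      intro k
      obtain ⟨C, hC⟩ := exists_bound_cutoff_smul ha k
      obtain ⟨C', hC'⟩ := exists_bound_cutoff_smul ha.matrix_conjTranspose k
      obtain ⟨C₁, hC₁⟩ := exists_bound_cutoff_smul
        (continuous_const (y := (1 : Matrix (Fin n) (Fin n) ℂ)) (X := Space s)) k
      have hs : ∀ ω : Space s, ((cutoff k ω : ℂ) • a ω)ᴴ = (cutoff k ω : ℂ) • (a ω)ᴴ := fun ω => by
        rw [Matrix.conjTranspose_smul]; simp
      have hs1 : ∀ ω : Space s, ((cutoff k ω : ℂ) • (1 : Matrix (Fin n) (Fin n) ℂ))ᴴ =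
          (cutoff k ω : ℂ) • (1 : Matrix (Fin n) (Fin n) ℂ) := fun ω => by
        rw [Matrix.conjTranspose_smul]; simp
      have h1 : (cutoffOp s n k).adjoint w =
          (boundedMultiplier _ (continuous_cutoff_smul ha k) C hC).adjoint g := by
        refine ext_inner_right ℂ fun f => ?_
        rw [ContinuousLinearMap.adjoint_inner_left, ContinuousLinearMap.adjoint_inner_left,
          ← multiplier_cutoffOp ha k f hC]
        have h2 := h _ _ (LinearPMap.mem_graph _ ⟨cutoffOp s n k f, cutoffOp_mem_domain ha k f⟩)
        rw [sub_eq_zero] at h2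
        have h3 := congrArg (starRingEnd ℂ) h2
        rw [inner_conj_symm, inner_conj_symm] at h3
        exact h3.symm
      rw [cutoffOp, boundedMultiplier_adjoint (C' := C₁) _ _ (fun ω => by rw [hs1]; exact hC₁ ω),
        boundedMultiplier_adjoint (C' := C') _ _ (fun ω => by rw [hs]; exact hC' ω)] at h1
      have h4 := fourier_boundedMultiplier (continuous_cutoff_smul continuous_const k
        ).matrix_conjTranspose (fun ω => by rw [hs1]; exact hC₁ ω) w
      have h5 := fourier_boundedMultiplier (continuous_cutoff_smul ha k).matrix_conjTranspose
        (fun ω => by rw [hs]; exact hC' ω) g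
      rw [h1] at h4
      filter_upwards [h4, h5] with ξ h6 h7
      rw [h6] at h7
      simpa only [symbolMul, hs, hs1, Matrix.smul_mulVec, Matrix.one_mulVec, WithLp.toLp_smul,
        WithLp.toLp_ofLp] using h7
    filter_upwards [ae_all_iff.2 key] with ξ hξ
    obtain ⟨k, hk⟩ := (eventually_cutoff_eq_one ((2 * Real.pi) • ξ)).exists
    simpa [hk] using hξ k
  · intro hw f v hv
    rw [mem_graph_multiplier] at hv
    rw [sub_eq_zero, inner_eq_inner_fourier, inner_eq_inner_fourier f, L2.inner_def, L2.inner_def]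
    refine integral_congr_ae ?_
    filter_upwards [hw, hv] with ξ h1 h2
    rw [h1, h2]
    have h3 := inner_toLp_mulVec (a ((2 * Real.pi) • ξ))ᴴ ((𝓕 g : L2 s m) ξ) ((𝓕 f : L2 s n) ξ)
    rw [Matrix.conjTranspose_conjTranspose] at h3
    exact h3.symm

/-- The operator is the adjoint of the densely defined multiplier with symbol `a*`, and adjoints are
closed. -/
lemma isClosed_multiplier {a : Space s → Matrix (Fin m) (Fin n) ℂ} (ha : Continuous a) :
    (multiplier a).IsClosed := by
  have h := LinearPMap.adjoint_isClosed (dense_multiplier_domain ha.matrix_conjTranspose)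
  rw [multiplier_adjoint ha.matrix_conjTranspose] at h
  simpa using h

lemma neg_multiplier (a : Space s → Matrix (Fin m) (Fin n) ℂ) :
    -multiplier a = multiplier fun ω => -a ω := by
  refine LinearPMap.eq_of_eq_graph (SetLike.ext ?_)
  rintro ⟨f, g⟩
  have h1 : (f, g) ∈ (-multiplier a).graph ↔ (f, -g) ∈ (multiplier a).graph := by
    simp only [LinearPMap.mem_graph_iff, LinearPMap.neg_apply, neg_eq_iff_eq_neg]
    rfl
  rw [h1, mem_graph_multiplier, mem_graph_multiplier, FourierTransform.fourier_neg]
  constructor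
  · intro h
    filter_upwards [h, Lp.coeFn_neg (𝓕 g : L2 s m)] with ξ h2 h3
    rw [h3, Pi.neg_apply, neg_eq_iff_eq_neg] at h2
    rw [h2]
    simp [symbolMul, Matrix.neg_mulVec]
  · intro h
    filter_upwards [h, Lp.coeFn_neg (𝓕 g : L2 s m)] with ξ h2 h3
    rw [h3, Pi.neg_apply, h2]
    simp [symbolMul, Matrix.neg_mulVec]

/-! ### Dissipative matrices -/

/-- The solution at time `t` of `x' = a x`. -/
def flow (a : Matrix (Fin n) (Fin n) ℂ) (x : EuclideanSpace ℂ (Fin n)) (t : ℝ) :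
    EuclideanSpace ℂ (Fin n) :=
  WithLp.toLp 2 (NormedSpace.exp (t • a) *ᵥ WithLp.ofLp x)

/-- The action of matrices on a Euclidean vector. -/
def applyVec (x : EuclideanSpace ℂ (Fin n)) :
    Matrix (Fin m) (Fin n) ℂ →L[ℂ] EuclideanSpace ℂ (Fin m) :=
  LinearMap.toContinuousLinearMap
    { toFun := fun a => WithLp.toLp 2 (a *ᵥ WithLp.ofLp x)
      map_add' := fun a b => by rw [Matrix.add_mulVec, WithLp.toLp_add]
      map_smul' := fun c a => by rw [Matrix.smul_mulVec, WithLp.toLp_smul, RingHom.id_apply] }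

lemma hasDerivAt_flow (a : Matrix (Fin n) (Fin n) ℂ) (x : EuclideanSpace ℂ (Fin n)) (t : ℝ) :
    HasDerivAt (flow a x) (WithLp.toLp 2 (a *ᵥ WithLp.ofLp (flow a x t))) t := by
  have h := (hasDerivAt_exp_smul_const' (𝕂 := ℂ) a (t : ℂ)).scomp t
    Complex.ofRealCLM.hasDerivAt
  have h2 := ((applyVec x).restrictScalars ℝ).hasFDerivAt.comp_hasDerivAt t h
  have e1 : flow a x = (applyVec x).restrictScalars ℝ ∘
      ((fun u : ℂ => NormedSpace.exp (u • a)) ∘ Complex.ofReal) := by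
    ext1 r
    simp [flow, applyVec]
  have e2 : WithLp.toLp 2 (a *ᵥ WithLp.ofLp (flow a x t)) = (applyVec x).restrictScalars ℝ
      (Complex.ofRealCLM 1 • (a * NormedSpace.exp ((t : ℂ) • a))) := by
    simp [flow, applyVec, Matrix.mulVec_mulVec]
  rw [e2, e1]
  exact h2

lemma flow_zero (a : Matrix (Fin n) (Fin n) ℂ) (x : EuclideanSpace ℂ (Fin n)) :
    flow a x 0 = x := by
  simp [flow]

lemma continuous_flow (a : Matrix (Fin n) (Fin n) ℂ) (x : EuclideanSpace ℂ (Fin n)) :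
    Continuous (flow a x) :=
  continuous_iff_continuousAt.2 fun t => (hasDerivAt_flow a x t).continuousAt

lemma re_inner_mulVec_nonpos {a : Matrix (Fin n) (Fin n) ℂ} (ha : (-(aᴴ + a)).PosSemidef)
    (x : EuclideanSpace ℂ (Fin n)) :
    (inner ℂ (WithLp.toLp 2 (a *ᵥ WithLp.ofLp x)) x).re ≤ 0 := by
  have h := ha.dotProduct_mulVec_nonneg (WithLp.ofLp x)
  have h1 := (Complex.le_def.1 h).1
  have e1 : inner ℂ (WithLp.toLp 2 (a *ᵥ WithLp.ofLp x)) x =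
      star (WithLp.ofLp x) ⬝ᵥ (aᴴ *ᵥ WithLp.ofLp x) := by
    have := inner_toLp_mulVec aᴴ x x
    rw [Matrix.conjTranspose_conjTranspose] at this
    rw [← this, EuclideanSpace.inner_eq_star_dotProduct, dotProduct_comm]
  have e2 : inner ℂ x (WithLp.toLp 2 (a *ᵥ WithLp.ofLp x)) =
      star (WithLp.ofLp x) ⬝ᵥ (a *ᵥ WithLp.ofLp x) := by
    rw [EuclideanSpace.inner_eq_star_dotProduct, dotProduct_comm]
  have e3 := congrArg Complex.re (inner_conj_symm (𝕜 := ℂ) x (WithLp.toLp 2 (a *ᵥ WithLp.ofLp x)))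
  rw [Complex.conj_re, e2] at e3
  rw [Matrix.neg_mulVec, dotProduct_neg, Matrix.add_mulVec, dotProduct_add, ← e1] at h1
  simp only [Complex.zero_re, Complex.neg_re, Complex.add_re] at h1
  linarith

lemma inner_real_eq_re (x y : EuclideanSpace ℂ (Fin n)) :
    inner ℝ x y = (inner ℂ x y).re := by
  simp [PiLp.inner_apply, Complex.inner, Complex.re_sum]

/-- Along the flow the squared norm has derivative `2 Re ⟨a x, x⟩ ≤ 0`. -/
lemma norm_flow_le {a : Matrix (Fin n) (Fin n) ℂ} (ha : (-(aᴴ + a)).PosSemidef)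
    (x : EuclideanSpace ℂ (Fin n)) {t : ℝ} (ht : 0 ≤ t) : ‖flow a x t‖ ≤ ‖x‖ := by
  have h : Antitone fun t => ‖flow a x t‖ ^ 2 := by
    refine antitone_of_hasDerivAt_nonpos (fun r => (hasDerivAt_flow a x r).norm_sq) fun r => ?_
    rw [inner_real_eq_re, ← inner_conj_symm, Complex.conj_re]
    have := re_inner_mulVec_nonpos ha (flow a x r)
    simp only [Pi.zero_apply]
    linarith
  have h2 := h ht
  simp only [flow_zero] at h2
  exact (sq_le_sq₀ (norm_nonneg _) (norm_nonneg _)).1 h2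

lemma norm_exp_smul_le_one {a : Matrix (Fin n) (Fin n) ℂ} (ha : (-(aᴴ + a)).PosSemidef)
    {t : ℝ} (ht : 0 ≤ t) : ‖NormedSpace.exp (t • a)‖ ≤ 1 := by
  rw [Matrix.l2_opNorm_def]
  refine ContinuousLinearMap.opNorm_le_bound _ zero_le_one fun x => ?_
  rw [one_mul]
  exact norm_flow_le ha x ht

/-- The velocity `a exp (r a) x = exp (r a) (a x)` has norm at most `‖a x‖` by contractivity. The
bound dominates the difference quotients of the semigroup on the domain of its generator. -/
lemma norm_flow_sub_le {a : Matrix (Fin n) (Fin n) ℂ} (ha : (-(aᴴ + a)).PosSemidef)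
    (x : EuclideanSpace ℂ (Fin n)) {t : ℝ} (ht : 0 ≤ t) :
    ‖flow a x t - x‖ ≤ ‖(WithLp.toLp 2 (a *ᵥ WithLp.ofLp x) : EuclideanSpace ℂ (Fin n))‖ * t := by
  have h := norm_image_sub_le_of_norm_deriv_le_segment' (f := flow a x) (a := 0) (b := t)
    (C := ‖(WithLp.toLp 2 (a *ᵥ WithLp.ofLp x) : EuclideanSpace ℂ (Fin n))‖)
    (fun r _ => (hasDerivAt_flow a x r).hasDerivWithinAt) (fun r hr => ?_) t ⟨ht, le_rfl⟩
  · rwa [flow_zero, sub_zero] at h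
  · have hc : Commute a (NormedSpace.exp (r • a)) :=
      ((Commute.refl a).smul_right r).exp_right
    have : (WithLp.toLp 2 (a *ᵥ WithLp.ofLp (flow a x r)) : EuclideanSpace ℂ (Fin n)) =
        flow a (WithLp.toLp 2 (a *ᵥ WithLp.ofLp x)) r := by
      simp [flow, Matrix.mulVec_mulVec, hc.eq]
    rw [this]
    exact norm_flow_le ha _ hr.1

end AdjointsAndSemigroups
-- The contraction semigroup generated by a dissipative symbol.
section Semigroup
open scoped Matrix.Norms.L2Operator

variable {s n m p : ℕ}

lemma continuous_expSymbol {a : Space s → Matrix (Fin n) (Fin n) ℂ} (ha : Continuous a) (t : ℝ) :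
    Continuous fun ω => NormedSpace.exp (max t 0 • a ω) := by
  let _ : NormedAlgebra ℚ (Matrix (Fin n) (Fin n) ℂ) := .restrictScalars ℚ ℂ _
  have h : Continuous fun ω => max t 0 • a ω := by fun_prop
  exact (NormedSpace.exp_continuous (𝔸 := Matrix (Fin n) (Fin n) ℂ)).comp h

/-- The bounded multiplier with symbol `exp (a t)`, extended by the identity to negative times. -/
def semigroupOp {a : Space s → Matrix (Fin n) (Fin n) ℂ} (ha : Continuous a)
    (hd : ∀ ω, (-((a ω)ᴴ + a ω)).PosSemidef) (t : ℝ) : L2 s n →L[ℂ] L2 s n :=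
  boundedMultiplier (fun ω => NormedSpace.exp (max t 0 • a ω)) (continuous_expSymbol ha t) 1
    fun ω => norm_exp_smul_le_one (hd ω) (le_max_right _ _)

section
variable {a : Space s → Matrix (Fin n) (Fin n) ℂ} (ha : Continuous a)
    (hd : ∀ ω, (-((a ω)ᴴ + a ω)).PosSemidef)

lemma fourier_semigroupOp (t : ℝ) (f : L2 s n) :
    ((𝓕 (semigroupOp ha hd t f) : L2 s n) : Space s → _) =ᵐ[volume]
      fun ξ => flow (rescale a ξ) ((𝓕 f : L2 s n) ξ) (max t 0) :=
  fourier_boundedMultiplier _ _ _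

/-- Dominated convergence in frequency, with majorant `2 ‖𝓕 f‖` from contractivity. The clamping
`max t 0` makes the statement hold on the whole line. -/
lemma continuous_semigroupOp (f : L2 s n) : Continuous fun t => semigroupOp ha hd t f := by
  refine continuous_iff_continuousAt.2 fun t => tendsto_of_fourier ?_
  refine tendsto_L2_of_dominated (g := fun ξ => 2 * ‖(𝓕 f : L2 s n) ξ‖)
    ((Lp.memLp (𝓕 f : L2 s n)).norm.const_mul 2) (fun r => fourier_semigroupOp ha hd r f)
    (.of_forall fun r => ?_) ?_
  · filter_upwards [fourier_semigroupOp ha hd t f] with ξ h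
    rw [h]
    refine (norm_sub_le _ _).trans ?_
    have h1 := norm_flow_le (a := rescale a ξ) (hd _) ((𝓕 f : L2 s n) ξ) (le_max_right r 0)
    have h2 := norm_flow_le (a := rescale a ξ) (hd _) ((𝓕 f : L2 s n) ξ) (le_max_right t 0)
    linarith
  · filter_upwards [fourier_semigroupOp ha hd t f] with ξ h
    rw [h]
    exact ((continuous_flow _ _).comp (continuous_id.max continuous_const)).tendsto t

lemma norm_semigroupOp_le (t : ℝ) (f : L2 s n) : ‖semigroupOp ha hd t f‖ ≤ ‖f‖ := by
  rw [← Lp.norm_fourier_eq, ← Lp.norm_fourier_eq f]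
  refine Lp.norm_le_norm_of_ae_le ?_
  filter_upwards [fourier_semigroupOp ha hd t f] with ξ h
  rw [h]
  exact norm_flow_le (a := rescale a ξ) (hd _) _ (le_max_right t 0)

lemma semigroupOp_zero : semigroupOp ha hd 0 = ContinuousLinearMap.id ℂ (L2 s n) := by
  ext1 f
  refine ext_fourier ?_
  filter_upwards [fourier_semigroupOp ha hd 0 f] with ξ h
  rw [h, max_self, flow_zero]
  rfl

/-- The `C₀`-semigroup of multipliers with symbols `exp (a t)`, for a dissipative symbol `a`. -/
def semigroup : C0Semigroup (L2 s n) where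
  op := semigroupOp ha hd
  map_zero := semigroupOp_zero ha hd
  map_add t r ht hr := by
    ext1 f
    refine ext_fourier ?_
    rw [ContinuousLinearMap.comp_apply]
    filter_upwards [fourier_semigroupOp ha hd (t + r) f, fourier_semigroupOp ha hd r f,
      fourier_semigroupOp ha hd t (semigroupOp ha hd r f)] with ξ h1 h2 h3
    rw [h1, h3, h2, max_eq_left ht, max_eq_left hr, max_eq_left (add_nonneg ht hr)]
    simp only [flow, Matrix.mulVec_mulVec, add_smul]
    rw [Matrix.exp_add_of_commute _ _ (((Commute.refl _).smul_left t).smul_right r)]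
  tendsto_zero z := by
    have h := (continuous_semigroupOp ha hd z).tendsto 0
    rw [semigroupOp_zero] at h
    exact h.mono_left nhdsWithin_le_nhds

lemma fourier_diffQuotient (f : L2 s n) (t : ℝ) :
    ((𝓕 ((t⁻¹ : ℝ) • (semigroupOp ha hd t f - f)) : L2 s n) : Space s → _) =ᵐ[volume]
      fun ξ => t⁻¹ • (flow (rescale a ξ) ((𝓕 f : L2 s n) ξ) (max t 0) - (𝓕 f : L2 s n) ξ) := by
  have h1 : (𝓕 ((t⁻¹ : ℝ) • (semigroupOp ha hd t f - f)) : L2 s n) =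
      (t⁻¹ : ℝ) • ((𝓕 (semigroupOp ha hd t f) : L2 s n) - 𝓕 f) := by
    have h2 : (𝓕 (semigroupOp ha hd t f - f) : L2 s n) = 𝓕 (semigroupOp ha hd t f) - 𝓕 f :=
      (Lp.fourierTransformₗᵢ (Space s) (EuclideanSpace ℂ (Fin n))).map_sub _ _
    rw [← h2]
    exact LinearMap.map_smul_of_tower (Lp.fourierTransformₗᵢ (Space s)
      (EuclideanSpace ℂ (Fin n))).toLinearEquiv.toLinearMap t⁻¹ (semigroupOp ha hd t f - f)
  rw [h1]
  filter_upwards [Lp.coeFn_smul (t⁻¹ : ℝ) ((𝓕 (semigroupOp ha hd t f) : L2 s n) - 𝓕 f),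
    Lp.coeFn_sub (𝓕 (semigroupOp ha hd t f) : L2 s n) (𝓕 f), fourier_semigroupOp ha hd t f]
    with ξ h2 h3 h4
  rw [h2, Pi.smul_apply, h3, Pi.sub_apply, h4]

lemma tendsto_flow_diffQuotient (b : Matrix (Fin n) (Fin n) ℂ) (x : EuclideanSpace ℂ (Fin n)) :
    Tendsto (fun t : ℝ => t⁻¹ • (flow b x (max t 0) - x)) (𝓝[>] 0)
      (𝓝 (WithLp.toLp 2 (b *ᵥ WithLp.ofLp x))) := by
  have h := (hasDerivAt_flow b x 0).tendsto_slope_zero_right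
  rw [flow_zero] at h
  refine h.congr' ?_
  filter_upwards [self_mem_nhdsWithin] with t ht
  rw [zero_add, max_eq_left (le_of_lt ht)]

/-- On the natural domain the difference quotients are bounded pointwise by `‖𝓕 w‖`, so dominated
convergence applies. Conversely, an `L₂` limit of the quotients is an a.e. limit along a
subsequence, and pointwise the limit can only be `a` times the transform. -/
lemma semigroup_hasGenerator : (semigroup ha hd).HasGenerator (multiplier a) := by
  intro z w
  change _ ↔ Tendsto (fun t : ℝ => (t⁻¹ : ℝ) • (semigroupOp ha hd t z - z)) _ _
  rw [mem_graph_multiplier]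
  constructor
  · intro h
    refine tendsto_of_fourier (tendsto_L2_of_dominated (g := fun ξ => 2 * ‖(𝓕 w : L2 s n) ξ‖)
      ((Lp.memLp (𝓕 w : L2 s n)).norm.const_mul 2) (fourier_diffQuotient ha hd z) ?_ ?_)
    · filter_upwards [self_mem_nhdsWithin] with t ht
      have ht : 0 < t := ht
      filter_upwards [h] with ξ hξ
      have h1 := norm_flow_sub_le (a := rescale a ξ) (hd _) ((𝓕 z : L2 s n) ξ) ht.le
      have h2 : (𝓕 w : L2 s n) ξ = WithLp.toLp 2 (rescale a ξ *ᵥ WithLp.ofLp ((𝓕 z : L2 s n) ξ)) :=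
        hξ
      rw [← h2] at h1
      refine (norm_sub_le _ _).trans ?_
      rw [norm_smul, max_eq_left ht.le, Real.norm_of_nonneg (inv_nonneg.2 ht.le)]
      have h3 : t⁻¹ * ‖flow (rescale a ξ) ((𝓕 z : L2 s n) ξ) t - (𝓕 z : L2 s n) ξ‖ ≤
          ‖(𝓕 w : L2 s n) ξ‖ := by
        rw [inv_mul_le_iff₀ ht, mul_comm]
        exact h1
      linarith
    · filter_upwards [h] with ξ hξ
      rw [hξ]
      exact tendsto_flow_diffQuotient _ _
  · intro h
    -- Passing to a sequence of times is needed both to extract an a.e. convergent subsequence and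
    -- to leave only countably many exceptional null sets.
    have hu : Tendsto (fun k : ℕ => (1 / ((k : ℝ) + 1))) atTop (𝓝[>] 0) :=
      tendsto_nhdsWithin_iff.2 ⟨tendsto_one_div_add_atTop_nhds_zero_nat,
        .of_forall fun k => Set.mem_Ioi.2 (by positivity)⟩
    have h1 := (((Lp.fourierTransformₗᵢ (Space s) (EuclideanSpace ℂ (Fin n))).continuous.tendsto
      _).comp h).comp hu
    have h2 := (tendstoInMeasure_of_tendsto_Lp h1).exists_seq_tendsto_ae
    obtain ⟨ns, hns, hlim⟩ := h2
    have h3 : ∀ᵐ ξ ∂volume, ∀ k : ℕ, _ :=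
      ae_all_iff.2 fun k : ℕ => fourier_diffQuotient ha hd z (1 / ((ns k : ℝ) + 1))
    filter_upwards [hlim, h3] with ξ h4 h5
    refine tendsto_nhds_unique h4 ?_
    refine ((tendsto_flow_diffQuotient (rescale a ξ) ((𝓕 z : L2 s n) ξ)).comp
      (hu.comp hns.tendsto_atTop)).congr fun k => ?_
    exact (h5 k).symm

end

end Semigroup
set_option linter.unusedSectionVars false
-- The dissipation inequality along mild solutions of a contraction semigroup.
section Passivity

variable {Z : Type*} [NormedAddCommGroup Z] [InnerProductSpace ℂ Z] [CompleteSpace Z]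

/-- A semigroup of contractions that is strongly continuous on the whole real line (with arbitrary
values at negative times). -/
structure C0Semigroup.IsContractive (T : C0Semigroup Z) : Prop where
  continuous_op : ∀ z, Continuous fun t => T.op t z
  norm_op_le : ∀ t z, ‖T.op t z‖ ≤ ‖z‖

namespace C0Semigroup

/-- The mild solution of `ż = A z + v`. -/
def mild (T : C0Semigroup Z) (z₀ : Z) (v : ℝ → Z) (t : ℝ) : Z :=
  T.op t z₀ + ∫ τ in (0 : ℝ)..t, T.op (t - τ) (v τ)

variable {T : C0Semigroup Z}

/-- The uniform bound on the operators upgrades strong continuity to joint continuity. -/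
lemma IsContractive.continuous_uncurry (hT : T.IsContractive) :
    Continuous fun p : ℝ × Z => T.op p.1 p.2 := by
  refine continuous_iff_continuousAt.2 fun ⟨t₀, z₀⟩ => tendsto_iff_norm_sub_tendsto_zero.2 ?_
  have h1 : Tendsto (fun p : ℝ × Z => ‖p.2 - z₀‖ + ‖T.op p.1 z₀ - T.op t₀ z₀‖) (𝓝 (t₀, z₀))
      (𝓝 0) := by
    have : Continuous fun p : ℝ × Z => ‖p.2 - z₀‖ + ‖T.op p.1 z₀ - T.op t₀ z₀‖ := by
      have := (hT.continuous_op z₀).comp (continuous_fst : Continuous (Prod.fst : ℝ × Z → ℝ))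
      simp only [Function.comp_def] at this
      fun_prop
    simpa using this.tendsto (t₀, z₀)
  refine squeeze_zero (fun _ => norm_nonneg _) (fun p => ?_) h1
  have h2 : T.op p.1 p.2 - T.op t₀ z₀ = T.op p.1 (p.2 - z₀) + (T.op p.1 z₀ - T.op t₀ z₀) := by
    rw [map_sub]; abel
  simp only [h2]
  exact (norm_add_le _ _).trans (add_le_add_left (hT.norm_op_le _ _) _)

lemma IsContractive.continuous_comp (hT : T.IsContractive) {X : Type*} [TopologicalSpace X]
    {f : X → ℝ} {g : X → Z} (hf : Continuous f) (hg : Continuous g) :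
    Continuous fun x => T.op (f x) (g x) :=
  hT.continuous_uncurry.comp (hf.prodMk hg)

lemma IsContractive.continuous_mild (hT : T.IsContractive) (z₀ : Z) {v : ℝ → Z}
    (hv : Continuous v) : Continuous (T.mild z₀ v) := by
  refine (hT.continuous_op z₀).add ?_
  refine intervalIntegral.continuous_parametric_intervalIntegral_of_continuous
    (f := fun t τ => T.op (t - τ) (v τ)) ?_ continuous_id
  exact hT.continuous_comp (by fun_prop) (by fun_prop)

lemma mild_zero (z₀ : Z) (v : ℝ → Z) : T.mild z₀ v 0 = z₀ := by
  simp [mild, T.map_zero]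

/-- By the semigroup law a mild solution can be restarted at time `x`; this localizes the
dissipation estimate to short intervals. -/
lemma IsContractive.mild_eq (hT : T.IsContractive) (z₀ : Z) {v : ℝ → Z} (hv : Continuous v)
    {x y : ℝ} (hx : 0 ≤ x) (hxy : x ≤ y) :
    T.mild z₀ v y = T.op (y - x) (T.mild z₀ v x) + ∫ σ in x..y, T.op (y - σ) (v σ) := by
  have hc : ∀ t : ℝ, Continuous fun σ => T.op (t - σ) (v σ) := fun t =>
    hT.continuous_comp (by fun_prop) hv
  have h1 : T.op (y - x) (T.op x z₀) = T.op y z₀ := by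
    rw [← ContinuousLinearMap.comp_apply, ← T.map_add _ _ (sub_nonneg.2 hxy) hx, sub_add_cancel]
  have h2 : T.op (y - x) (∫ σ in (0 : ℝ)..x, T.op (x - σ) (v σ)) =
      ∫ σ in (0 : ℝ)..x, T.op (y - σ) (v σ) := by
    rw [← ContinuousLinearMap.intervalIntegral_comp_comm _ ((hc x).intervalIntegrable _ _)]
    refine intervalIntegral.integral_congr fun σ hσ => ?_
    rw [Set.uIcc_of_le hx] at hσ
    rw [← ContinuousLinearMap.comp_apply, ← T.map_add _ _ (sub_nonneg.2 hxy)
      (sub_nonneg.2 hσ.2), sub_add_sub_cancel]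
  rw [mild, mild, ContinuousLinearMap.map_add, h1, h2, add_assoc, intervalIntegral.integral_add_adjacent_intervals
    ((hc y).intervalIntegrable _ _) ((hc y).intervalIntegrable _ _)]

lemma IsContractive.tendsto_average (hT : T.IsContractive) {v : ℝ → Z} (hv : Continuous v)
    (x : ℝ) : Tendsto (fun y => (y - x)⁻¹ • ∫ σ in x..y, T.op (y - σ) (v σ)) (𝓝[>] x)
      (𝓝 (v x)) := by
  rw [Metric.tendsto_nhds]
  intro ε hε
  have hF : Continuous fun p : ℝ × ℝ => ‖T.op (p.1 - p.2) (v p.2) - v x‖ :=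
    ((hT.continuous_comp (by fun_prop) (by fun_prop)).sub continuous_const).norm
  have h0 : ∀ᶠ p in 𝓝 (x, x), ‖T.op (p.1 - p.2) (v p.2) - v x‖ < ε / 2 := by
    refine hF.continuousAt.eventually_lt continuousAt_const ?_
    simp [T.map_zero, hε]
  obtain ⟨δ, hδ, hball⟩ := Metric.eventually_nhds_iff.1 h0
  filter_upwards [Ioo_mem_nhdsGT (show x < x + δ by linarith)] with y hy
  have hy0 : 0 < y - x := sub_pos.2 hy.1
  have hc : Continuous fun σ => T.op (y - σ) (v σ) := hT.continuous_comp (by fun_prop) hv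
  have h1 : (y - x)⁻¹ • (∫ σ in x..y, T.op (y - σ) (v σ)) - v x =
      (y - x)⁻¹ • ∫ σ in x..y, (T.op (y - σ) (v σ) - v x) := by
    rw [intervalIntegral.integral_sub (hc.intervalIntegrable _ _) (by simp), smul_sub,
      intervalIntegral.integral_const, inv_smul_smul₀ hy0.ne']
  have h2 : ‖∫ σ in x..y, (T.op (y - σ) (v σ) - v x)‖ ≤ ε / 2 * |y - x| := by
    refine intervalIntegral.norm_integral_le_of_norm_le_const fun σ hσ => ?_
    rw [Set.uIoc_of_le hy.1.le] at hσ
    refine (hball (y := (y, σ)) ?_).le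
    rw [Prod.dist_eq, max_lt_iff, Real.dist_eq, Real.dist_eq, abs_lt, abs_lt]
    refine ⟨⟨?_, ?_⟩, ?_, ?_⟩ <;> simp only <;> linarith [hσ.1, hσ.2, hy.1, hy.2]
  rw [dist_eq_norm, h1, norm_smul, norm_inv, Real.norm_eq_abs]
  rw [abs_of_pos hy0] at h2 ⊢
  rw [inv_mul_lt_iff₀ hy0]
  nlinarith

lemma norm_add_sq_le_of_norm_le {a b z : Z} (h : ‖a‖ ≤ ‖z‖) :
    ‖a + b‖ ^ 2 ≤ ‖z‖ ^ 2 + 2 * (inner ℂ b a).re + ‖b‖ ^ 2 := by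
  have h1 := norm_add_sq (𝕜 := ℂ) b a
  have h2 := pow_le_pow_left₀ (norm_nonneg a) h 2
  rw [add_comm a b, h1]
  simp only [RCLike.re_to_complex]
  linarith

/-- The dissipation inequality for continuous inputs. -/
lemma IsContractive.dissipation_of_continuous (hT : T.IsContractive) (z₀ : Z) {v : ℝ → Z}
    (hv : Continuous v) {t : ℝ} (ht : 0 ≤ t) :
    ‖T.mild z₀ v t‖ ^ 2 ≤ ‖z₀‖ ^ 2 + 2 * ∫ τ in (0 : ℝ)..t, (inner ℂ (v τ) (T.mild z₀ v τ)).re := by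
  set z := T.mild z₀ v with hz
  have hzc : Continuous z := hT.continuous_mild z₀ hv
  have hgc : Continuous fun τ => (inner ℂ (v τ) (z τ)).re := by fun_prop
  set G : ℝ → ℝ := fun y => ∫ τ in (0 : ℝ)..y, (inner ℂ (v τ) (z τ)).re with hG
  have hGd : ∀ x, HasDerivAt G (inner ℂ (v x) (z x)).re x := fun x =>
    intervalIntegral.integral_hasDerivAt_right (hgc.intervalIntegrable _ _)
      (hgc.stronglyMeasurableAtFilter _ _) hgc.continuousAt
  have hGc : Continuous G := continuous_iff_continuousAt.2 fun x => (hGd x).continuousAt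
  -- For a general initial state the mild solution is not differentiable. A bound on the right lower
  -- Dini derivative of `‖z‖² - 2 G` still suffices for monotonicity.
  have key := image_le_of_liminf_slope_right_le_deriv_boundary
    (f := fun y => ‖z y‖ ^ 2 - 2 * G y) (a := 0) (b := t) (B := fun _ => ‖z₀‖ ^ 2)
    (B' := fun _ => 0) (by fun_prop) (by simp [hG, hz, mild_zero]) (by fun_prop)
    (fun x _ => hasDerivWithinAt_const _ _ _) ?_
  · have := key (Set.right_mem_Icc.2 ht)
    linarith
  intro x hx r hr
  set J : ℝ → Z := fun y => (y - x)⁻¹ • ∫ σ in x..y, T.op (y - σ) (v σ) with hJ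
  have hJt : Tendsto J (𝓝[>] x) (𝓝 (v x)) := hT.tendsto_average hv x
  have hid : Tendsto (fun y : ℝ => y - x) (𝓝[>] x) (𝓝 0) := by
    have : Tendsto (fun y : ℝ => y - x) (𝓝 x) (𝓝 (x - x)) :=
      (continuous_id.sub continuous_const).tendsto x
    rw [sub_self] at this
    exact this.mono_left nhdsWithin_le_nhds
  have hTz : Tendsto (fun y => T.op (y - x) (z x)) (𝓝[>] x) (𝓝 (z x)) := by
    have := ((hT.continuous_op (z x)).tendsto 0).comp hid
    simpa [Function.comp_def, T.map_zero] using this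
  have hGs : Tendsto (slope G x) (𝓝[>] x) (𝓝 (inner ℂ (v x) (z x)).re) :=
    (hasDerivAt_iff_tendsto_slope.1 (hGd x)).mono_left
      (nhdsWithin_mono _ fun y hy => ne_of_gt hy)
  -- This function majorizes the slope: expand the square of `z y = T (y - x) (z x) + (y - x) J y`,
  -- use contractivity for the first term, and divide by `y - x`. In the limit the supply rate
  -- cancels against the slope of `G`.
  have hψ : Tendsto (fun y => 2 * (inner ℂ (J y) (T.op (y - x) (z x))).re + (y - x) * ‖J y‖ ^ 2 -
      2 * slope G x y) (𝓝[>] x) (𝓝 0) := by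
    have h1 := (((Complex.continuous_re.tendsto _).comp (hJt.inner (𝕜 := ℂ) hTz)).const_mul 2).add
      (hid.mul (hJt.norm.pow 2)) |>.sub (hGs.const_mul 2)
    simpa using h1
  refine Eventually.frequently ?_
  filter_upwards [hψ.eventually_lt_const hr, self_mem_nhdsWithin] with y hy1 hy2
  have hy0 : 0 < y - x := sub_pos.2 hy2
  refine lt_of_le_of_lt ?_ hy1
  have hI : z y = T.op (y - x) (z x) + (y - x) • J y := by
    rw [hJ, smul_inv_smul₀ hy0.ne']
    exact hT.mild_eq z₀ hv hx.1 (le_of_lt hy2)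
  have h3 := norm_add_sq_le_of_norm_le (b := (y - x) • J y) (hT.norm_op_le (y - x) (z x))
  rw [← hI, norm_smul, Real.norm_of_nonneg hy0.le, ← Complex.coe_smul, inner_smul_left,
    Complex.conj_ofReal, Complex.re_ofReal_mul] at h3
  simp only [slope_def_field]
  rw [div_le_iff₀ hy0]
  have h4 : (G y - G x) / (y - x) * (y - x) = G y - G x := div_mul_cancel₀ _ hy0.ne'
  nlinarith

lemma IsContractive.aestronglyMeasurable_comp (hT : T.IsContractive) {v : ℝ → Z} {t : ℝ}
    {S : Set ℝ} (hv : AEStronglyMeasurable v (volume.restrict S)) :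
    AEStronglyMeasurable (fun τ => T.op (t - τ) (v τ)) (volume.restrict S) :=
  hT.continuous_uncurry.comp_aestronglyMeasurable
    ((by fun_prop : Continuous fun τ : ℝ => t - τ).aestronglyMeasurable.prodMk hv)

lemma IsContractive.intervalIntegrable_comp (hT : T.IsContractive) {v : ℝ → Z} {t a b : ℝ}
    (hv : IntervalIntegrable v volume a b) :
    IntervalIntegrable (fun τ => T.op (t - τ) (v τ)) volume a b :=
  hv.mono_fun (hT.aestronglyMeasurable_comp hv.def'.aestronglyMeasurable)
    (.of_forall fun _ => hT.norm_op_le _ _)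

/-- Contractivity makes the mild solution Lipschitz in the `L₁` norm of the input, uniformly in
time. The dissipation inequality then extends from continuous to integrable inputs. -/
lemma IsContractive.norm_mild_sub_le (hT : T.IsContractive) (z₀ : Z) {v w : ℝ → Z} {t τ : ℝ}
    (hv : IntervalIntegrable v volume 0 t) (hw : IntervalIntegrable w volume 0 t)
    (hτ : τ ∈ Set.Icc 0 t) :
    ‖T.mild z₀ v τ - T.mild z₀ w τ‖ ≤ ∫ σ in (0 : ℝ)..t, ‖v σ - w σ‖ := by
  have hsub : Set.uIcc 0 τ ⊆ Set.uIcc 0 t := by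
    rw [Set.uIcc_of_le hτ.1, Set.uIcc_of_le (hτ.1.trans hτ.2)]
    exact Set.Icc_subset_Icc_right hτ.2
  have hv' := hv.mono_set hsub
  have hw' := hw.mono_set hsub
  rw [mild, mild, add_sub_add_left_eq_sub, ← intervalIntegral.integral_sub
    (hT.intervalIntegrable_comp hv') (hT.intervalIntegrable_comp hw')]
  refine (intervalIntegral.norm_integral_le_of_norm_le hτ.1 (.of_forall fun σ _ => ?_)
    (hv'.sub hw').norm).trans ?_
  · rw [← map_sub]
    exact hT.norm_op_le _ _
  · exact intervalIntegral.integral_mono_interval le_rfl hτ.1 hτ.2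
      (.of_forall fun _ => norm_nonneg _) (hv.sub hw).norm

lemma IsContractive.norm_mild_le (hT : T.IsContractive) (z₀ : Z) {v : ℝ → Z} {t τ : ℝ}
    (hv : IntervalIntegrable v volume 0 t) (hτ : τ ∈ Set.Icc 0 t) :
    ‖T.mild z₀ v τ‖ ≤ ‖z₀‖ + ∫ σ in (0 : ℝ)..t, ‖v σ‖ := by
  have h := hT.norm_mild_sub_le z₀ hv (w := fun _ => 0) (by simp) hτ
  have h2 : T.mild z₀ (fun _ => 0) τ = T.op τ z₀ := by simp [mild]
  simp only [sub_zero, h2] at h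
  have h3 := norm_add_le (T.mild z₀ v τ - T.op τ z₀) (T.op τ z₀)
  rw [sub_add_cancel] at h3
  linarith [hT.norm_op_le τ z₀]

lemma exists_continuous_tendsto {v : ℝ → Z} {t : ℝ} (ht : 0 ≤ t)
    (hv : IntervalIntegrable v volume 0 t) :
    ∃ w : ℕ → ℝ → Z, (∀ k, Continuous (w k)) ∧
      Tendsto (fun k => ∫ σ in (0 : ℝ)..t, ‖v σ - w k σ‖) atTop (𝓝 0) := by
  have hv' : Integrable v (volume.restrict (Set.Ioc 0 t)) :=
    (intervalIntegrable_iff_integrableOn_Ioc_of_le ht).1 hv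
  have h : ∀ k : ℕ, ∃ w : ℝ → Z, Continuous w ∧
      ∫ σ in (0 : ℝ)..t, ‖v σ - w σ‖ ≤ 1 / ((k : ℝ) + 1) := fun k => by
    obtain ⟨w, -, hw, hwc, -⟩ := hv'.exists_hasCompactSupport_integral_sub_le
      (show (0 : ℝ) < 1 / ((k : ℝ) + 1) by positivity)
    exact ⟨w, hwc, by rwa [intervalIntegral.integral_of_le ht]⟩
  choose w hwc hw using h
  exact ⟨w, hwc, squeeze_zero (fun k => intervalIntegral.integral_nonneg ht
    fun _ _ => norm_nonneg _) hw tendsto_one_div_add_atTop_nhds_zero_nat⟩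

/-- The dissipation inequality for integrable inputs. -/
lemma IsContractive.dissipation (hT : T.IsContractive) (z₀ : Z) {v : ℝ → Z} {t : ℝ} (ht : 0 ≤ t)
    (hv : IntervalIntegrable v volume 0 t) :
    ‖T.mild z₀ v t‖ ^ 2 ≤ ‖z₀‖ ^ 2 + 2 * ∫ τ in (0 : ℝ)..t, (inner ℂ (v τ) (T.mild z₀ v τ)).re := by
  obtain ⟨w, hwc, hw⟩ := exists_continuous_tendsto ht hv
  set δ : ℕ → ℝ := fun k => ∫ σ in (0 : ℝ)..t, ‖v σ - w k σ‖ with hδ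
  have hwi : ∀ k, IntervalIntegrable (w k) volume 0 t := fun k => (hwc k).intervalIntegrable _ _
  have hclose : ∀ k, ∀ τ ∈ Set.Icc 0 t, ‖T.mild z₀ v τ - T.mild z₀ (w k) τ‖ ≤ δ k :=
    fun k τ hτ => hT.norm_mild_sub_le z₀ hv (hwi k) hτ
  have hlim : ∀ τ ∈ Set.Icc 0 t, Tendsto (fun k => T.mild z₀ (w k) τ) atTop (𝓝 (T.mild z₀ v τ)) :=
    fun τ hτ => tendsto_iff_norm_sub_tendsto_zero.2
      (squeeze_zero (fun _ => norm_nonneg _)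
        (fun k => by rw [norm_sub_rev]; exact hclose k τ hτ) hw)
  have hΙ : Set.uIoc 0 t = Set.Ioc 0 t := Set.uIoc_of_le ht
  -- Measurability comes from the approximation: the solution is a pointwise limit of the continuous
  -- solutions with continuous inputs.
  have hzm : AEStronglyMeasurable (T.mild z₀ v) (volume.restrict (Set.uIoc 0 t)) := by
    refine aestronglyMeasurable_of_tendsto_ae atTop
      (fun k => (hT.continuous_mild z₀ (hwc k)).aestronglyMeasurable) ?_
    refine (ae_restrict_iff' measurableSet_uIoc).2 (.of_forall fun τ hτ => hlim τ ?_)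
    rw [hΙ] at hτ
    exact Set.Ioc_subset_Icc_self hτ
  set M := ‖z₀‖ + ∫ σ in (0 : ℝ)..t, ‖v σ‖ with hM
  have hbnd : ∀ τ ∈ Set.Icc 0 t, ‖T.mild z₀ v τ‖ ≤ M := fun τ hτ => hT.norm_mild_le z₀ hv hτ
  have hgi : IntervalIntegrable (fun τ => (inner ℂ (v τ) (T.mild z₀ v τ)).re) volume 0 t := by
    refine (hv.norm.mul_const M).mono_fun ?_ ?_
    · exact Complex.continuous_re.comp_aestronglyMeasurable
        (hv.def'.aestronglyMeasurable.inner hzm)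
    · refine (ae_restrict_iff' measurableSet_uIoc).2 (.of_forall fun τ hτ => ?_)
      rw [hΙ] at hτ
      have h1 := hbnd τ (Set.Ioc_subset_Icc_self hτ)
      refine (Complex.abs_re_le_norm _).trans ((norm_inner_le_norm _ _).trans ?_)
      exact (mul_le_mul_of_nonneg_left h1 (norm_nonneg _)).trans (le_abs_self _)
  have hgk : ∀ k, IntervalIntegrable (fun τ => (inner ℂ (w k τ) (T.mild z₀ (w k) τ)).re)
      volume 0 t := fun k => by
    have h1 := hT.continuous_mild z₀ (hwc k)
    have h2 := hwc k
    exact (by fun_prop : Continuous fun τ =>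
      (inner ℂ (w k τ) (T.mild z₀ (w k) τ)).re).intervalIntegrable _ _
  have hint : Tendsto (fun k => ∫ τ in (0 : ℝ)..t, (inner ℂ (w k τ) (T.mild z₀ (w k) τ)).re) atTop
      (𝓝 (∫ τ in (0 : ℝ)..t, (inner ℂ (v τ) (T.mild z₀ v τ)).re)) := by
    refine tendsto_iff_norm_sub_tendsto_zero.2 (squeeze_zero (fun _ => norm_nonneg _)
      -- The first term pays for changing the input, since the approximate states are bounded by `M
      -- + δ k`; the second pays for changing the state by at most `δ k`.
      (g := fun k => δ k * (M + δ k) + (∫ σ in (0 : ℝ)..t, ‖v σ‖) * δ k) (fun k => ?_) ?_)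
    · rw [← intervalIntegral.integral_sub (hgk k) hgi]
      have hb : ∀ τ ∈ Set.Ioc 0 t, ‖(inner ℂ (w k τ) (T.mild z₀ (w k) τ)).re -
          (inner ℂ (v τ) (T.mild z₀ v τ)).re‖ ≤ ‖v τ - w k τ‖ * (M + δ k) + ‖v τ‖ * δ k := by
        intro τ hτ
        have h1 := hclose k τ (Set.Ioc_subset_Icc_self hτ)
        have h2 := hbnd τ (Set.Ioc_subset_Icc_self hτ)
        have h3 : ‖T.mild z₀ (w k) τ‖ ≤ M + δ k := by
          have := norm_sub_norm_le (T.mild z₀ (w k) τ) (T.mild z₀ v τ)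
          rw [norm_sub_rev] at this
          linarith
        have h4 : inner ℂ (w k τ) (T.mild z₀ (w k) τ) - inner ℂ (v τ) (T.mild z₀ v τ) =
            -(inner ℂ (v τ - w k τ) (T.mild z₀ (w k) τ) +
              inner ℂ (v τ) (T.mild z₀ v τ - T.mild z₀ (w k) τ)) := by
          rw [inner_sub_left, inner_sub_right]; ring
        rw [← Complex.sub_re, h4, Real.norm_eq_abs]
        refine (Complex.abs_re_le_norm _).trans ?_
        rw [norm_neg]
        refine (norm_add_le _ _).trans (add_le_add ?_ ?_)
        · exact (norm_inner_le_norm _ _).trans (mul_le_mul_of_nonneg_left h3 (norm_nonneg _))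
        · exact (norm_inner_le_norm _ _).trans (mul_le_mul_of_nonneg_left h1 (norm_nonneg _))
      have hi1 := (hv.sub (hwi k)).norm.mul_const (M + δ k)
      have hi2 := hv.norm.mul_const (δ k)
      refine (intervalIntegral.norm_integral_le_of_norm_le ht (.of_forall hb)
        (hi1.add hi2)).trans_eq ?_
      rw [intervalIntegral.integral_add hi1 hi2, intervalIntegral.integral_mul_const,
        intervalIntegral.integral_mul_const]
    · have := (hw.mul (hw.const_add M)).add (hw.const_mul (∫ σ in (0 : ℝ)..t, ‖v σ‖))
      simpa using this
  refine le_of_tendsto_of_tendsto' ((hlim t (Set.right_mem_Icc.2 ht)).norm.pow 2)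
    ((hint.const_mul 2).const_add _) fun k => hT.dissipation_of_continuous z₀ (hwc k) ht

end C0Semigroup

/-- A system with collocated input and output (`C = B*`) and a contraction semigroup is internally
impedance passive. -/
lemma isInternallyImpedancePassive_of_isContractive {U : Type*} [NormedAddCommGroup U]
    [InnerProductSpace ℂ U] [CompleteSpace U] {sys : StateSystem U Z U} {T : C0Semigroup Z}
    (hgen : T.HasGenerator sys.A) (hT : T.IsContractive) (hC : sys.C = sys.B.adjoint) :
    sys.IsInternallyImpedancePassive T := by
  refine ⟨hgen, fun z₀ t u ht hu => ?_⟩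
  have hu1 : IntervalIntegrable u volume 0 t := by
    rw [intervalIntegrable_iff_integrableOn_Icc_of_le ht]
    exact hu.integrable (by norm_num)
  have hv : IntervalIntegrable (fun τ => sys.B (u τ)) volume 0 t :=
    ⟨sys.B.integrable_comp hu1.1, sys.B.integrable_comp hu1.2⟩
  have h := hT.dissipation z₀ ht hv
  -- With `C = B*` the supply rate depends only on the effective input `B u`, and the output drops
  -- out.
  have e : ∀ τ, inner ℂ (u τ) (sys.C (sys.state T z₀ u τ)) =
      inner ℂ (sys.B (u τ)) (T.mild z₀ (fun τ => sys.B (u τ)) τ) := fun τ => by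
    rw [hC, ContinuousLinearMap.adjoint_inner_right]
    rfl
  simp only [e]
  change (1 / 2 : ℝ) * ‖T.mild z₀ (fun τ => sys.B (u τ)) t‖ ^ 2 ≤ _
  linarith

end Passivity
-- Square roots, and continuous diagonalization of families of involutions.
section Frames

/-- Continuous families of nonnegative elements of a `C⋆`-algebra have continuous square roots. -/
lemma exists_continuous_sqrt {A X : Type*} [CStarAlgebra A] [TopologicalSpace X] {M : X → A}
    (hM : Continuous M) (hsa : ∀ x, IsSelfAdjoint (M x))
    (hpos : ∀ x, ∀ z ∈ spectrum ℂ (M x), 0 ≤ z) :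
    ∃ R : X → A, Continuous R ∧ ∀ x, IsSelfAdjoint (R x) ∧ R x * R x = M x ∧
      ∀ b, Commute (M x) b → Commute (R x) b := by
  refine ⟨fun x => cfc Real.sqrt (M x), hM.cfc_of_mem_nhdsSet (s := Set.univ) Real.sqrt
    Filter.univ_mem hsa Real.continuous_sqrt.continuousOn, fun x => ⟨cfc_predicate _ _, ?_, ?_⟩⟩
  · rw [← cfc_mul Real.sqrt Real.sqrt (M x) Real.continuous_sqrt.continuousOn
      Real.continuous_sqrt.continuousOn]
    conv_rhs => rw [← cfc_id ℝ (M x) (hsa x)]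
    refine cfc_congr fun r hr => Real.mul_self_sqrt ?_
    have := hpos x _ (spectrum.algebraMap_mem (S := ℂ) hr)
    simpa using this
  · intro b hb
    exact hb.cfc_real Real.sqrt

open scoped Matrix.Norms.L2Operator

variable {s n m p : ℕ}

/-- The signature matrix with `k` entries `1`, followed by entries `-1`. -/
def signature (n k : ℕ) : Matrix (Fin n) (Fin n) ℂ :=
  Matrix.diagonal fun i => if (i : ℕ) < k then 1 else -1

lemma signature_mul_self (n k : ℕ) : signature n k * signature n k = 1 := by
  rw [signature, Matrix.diagonal_mul_diagonal, ← Matrix.diagonal_one]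
  congr 1
  ext i
  split_ifs <;> simp

lemma conjTranspose_signature (n k : ℕ) : (signature n k)ᴴ = signature n k := by
  rw [signature, Matrix.diagonal_conjTranspose]
  congr 1
  ext i
  simp only [Pi.star_apply]
  split_ifs <;> simp

/-- The eigenspaces for `1` and `-1` are complementary, by `x = (x + E x) / 2 + (x - E x) / 2`. A
basis adapted to them, with the `1`-eigenvectors first, supplies the columns of `V`. -/
lemma exists_signature_of_involution {E : Matrix (Fin n) (Fin n) ℂ} (hE : E * E = 1) :
    ∃ n₁ n₂ : ℕ, n₁ + n₂ = n ∧ ∃ V : Matrix (Fin n) (Fin n) ℂ, IsUnit V ∧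
      E * V = V * signature n n₁ := by
  set T := Matrix.toLin' E with hT
  have hTT : ∀ x, T (T x) = x := fun x => by
    simp [hT, Matrix.mulVec_mulVec, hE]
  let P := LinearMap.ker (T - LinearMap.id)
  let N := LinearMap.ker (T + LinearMap.id)
  have hPm : ∀ x, x ∈ P ↔ T x = x := fun x => by
    simp [P, LinearMap.mem_ker, sub_eq_zero]
  have hNm : ∀ x, x ∈ N ↔ T x = -x := fun x => by
    simp [N, LinearMap.mem_ker, add_eq_zero_iff_eq_neg]
  have hPN : IsCompl P N := by
    refine isCompl_iff.2 ⟨Submodule.disjoint_def.2 fun x hx hy => ?_,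
      codisjoint_iff.2 (Submodule.eq_top_iff'.2 fun x => ?_)⟩
    · rw [hPm] at hx
      rw [hNm, hx] at hy
      exact self_eq_neg.1 hy
    · refine Submodule.mem_sup.2 ⟨(1 / 2 : ℂ) • (x + T x), ?_, (1 / 2 : ℂ) • (x - T x), ?_, ?_⟩
      · rw [hPm, map_smul, map_add, hTT, add_comm]
      · rw [hNm, map_smul, map_sub, hTT, ← smul_neg, neg_sub]
      · rw [← smul_add]
        have : x + T x + (x - T x) = (2 : ℂ) • x := by rw [two_smul]; abel
        rw [this, smul_smul]; norm_num
  let b₀ := ((Module.finBasis ℂ P).prod (Module.finBasis ℂ N)).map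
    (Submodule.prodEquivOfIsCompl P N hPN)
  have hcard : Module.finrank ℂ P + Module.finrank ℂ N = n := by
    have := Submodule.finrank_add_eq_of_isCompl hPN
    simpa using this
  refine ⟨_, _, hcard, ?_⟩
  let e : Fin (Module.finrank ℂ P) ⊕ Fin (Module.finrank ℂ N) ≃ Fin n :=
    finSumFinEquiv.trans (finCongr hcard)
  let b := b₀.reindex e
  have hcol : ∀ j, T (b j) = (if (j : ℕ) < Module.finrank ℂ P then (1 : ℂ) else -1) • b j := by
    intro j
    obtain ⟨j, rfl⟩ := e.surjective j
    have hb : b (e j) = b₀ j := by simp [b]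
    rw [hb]
    rcases j with j | j
    · have hv : ((e (Sum.inl j) : Fin n) : ℕ) < Module.finrank ℂ P := by simp [e]
      have hmem : b₀ (Sum.inl j) ∈ P := by simp [b₀]
      rw [if_pos hv, one_smul, (hPm _).1 hmem]
    · have hv : ¬ ((e (Sum.inr j) : Fin n) : ℕ) < Module.finrank ℂ P := by simp [e]
      have hmem : b₀ (Sum.inr j) ∈ N := by simp [b₀]
      rw [if_neg hv, neg_one_smul, (hNm _).1 hmem]
  refine ⟨(Pi.basisFun ℂ (Fin n)).toMatrix b, ?_, ?_⟩
  · exact IsUnit.of_mul_eq_one _ (Module.Basis.toMatrix_mul_toMatrix_flip _ b)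
  · ext i j
    rw [signature, Matrix.mul_diagonal, Matrix.mul_apply]
    have h := congrFun (hcol j) i
    simp only [hT, Matrix.toLin'_apply, Matrix.mulVec, dotProduct, Pi.smul_apply, smul_eq_mul] at h
    simp only [Module.Basis.toMatrix_apply, Pi.basisFun_repr]
    rw [h, mul_comm]

/-! ### Transport of frames along rays -/

/-- The radial retraction to the ball of radius `r`. -/
def retract (r : ℝ) (ω : Space s) : Space s := (r / max r ‖ω‖) • ω

lemma retract_zero (ω : Space s) : retract 0 ω = 0 := by simp [retract]

lemma retract_of_norm_le {r : ℝ} (hr : 0 ≤ r) {ω : Space s} (h : ‖ω‖ ≤ r) : retract r ω = ω := by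
  rcases hr.eq_or_lt with rfl | hr
  · have : ω = 0 := by simpa using h
    simp [retract, this]
  · rw [retract, max_eq_left h, div_self hr.ne', one_smul]

lemma continuous_retract {r : ℝ} (hr : 0 ≤ r) : Continuous (retract r : Space s → Space s) := by
  rcases hr.eq_or_lt with rfl | hr
  · simp only [funext retract_zero]
    exact continuous_const
  · unfold retract
    refine Continuous.smul (continuous_const.div (continuous_const.max continuous_norm) fun ω => ?_)
      continuous_id
    exact (lt_max_of_lt_left hr).ne'

lemma norm_retract_le {r : ℝ} (hr : 0 ≤ r) (ω : Space s) : ‖retract r ω‖ ≤ r := by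
  rcases le_or_gt ‖ω‖ r with h | h
  · rwa [retract_of_norm_le hr h]
  · have h0 : 0 < ‖ω‖ := hr.trans_lt h
    rw [retract, max_eq_right h.le, norm_smul, norm_div, norm_norm, Real.norm_of_nonneg hr,
      div_mul_cancel₀ _ h0.ne']

/-- The two retractions differ only along the ray through `ω`. The bound is uniform in `ω`, which
permits a fixed step size in the transport. -/
lemma dist_retract_le {r r' : ℝ} (hr : 0 ≤ r) (hrr' : r ≤ r') (ω : Space s) :
    dist (retract r' ω) (retract r ω) ≤ r' - r := by
  have hr' := hr.trans hrr'
  rcases le_or_gt ‖ω‖ r with h | h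
  · rw [retract_of_norm_le hr h, retract_of_norm_le hr' (h.trans hrr'), dist_self]
    linarith
  · have h0 : 0 < ‖ω‖ := hr.trans_lt h
    rcases le_or_gt ‖ω‖ r' with h' | h'
    · rw [retract_of_norm_le hr' h', retract, max_eq_right h.le, dist_eq_norm]
      have : ω - (r / ‖ω‖) • ω = ((‖ω‖ - r) / ‖ω‖) • ω := by
        rw [sub_div, div_self h0.ne', sub_smul, one_smul]
      rw [this, norm_smul, norm_div, norm_norm, div_mul_cancel₀ _ h0.ne',
        Real.norm_of_nonneg (by linarith)]
      linarith
    · rw [retract, retract, max_eq_right h.le, max_eq_right h'.le, dist_eq_norm, ← sub_smul,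
        ← sub_div, norm_smul, norm_div, norm_norm, div_mul_cancel₀ _ h0.ne',
        Real.norm_of_nonneg (by linarith)]

/-- `V` is a continuous frame that diagonalizes the involutions `E` over the ball of radius `r`
(pulled back to the whole space by the radial retraction). -/
structure IsFrame (E : Space s → Matrix (Fin n) (Fin n) ℂ) (D : Matrix (Fin n) (Fin n) ℂ) (r : ℝ)
    (V : Space s → Matrix (Fin n) (Fin n) ℂ) : Prop where
  continuous : Continuous V
  isUnit : ∀ ω, IsUnit (V ω)
  intertwines : ∀ ω, E (retract r ω) * V ω = V ω * D

variable {E : Space s → Matrix (Fin n) (Fin n) ℂ} {D : Matrix (Fin n) (Fin n) ℂ}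

/-- For involutions `E'` and `E`, the matrix `W = (1 + E' E) / 2` satisfies `E' W = (E' + E) / 2 = W
E`, so it carries eigenvectors of `E` to those of `E'`. It is invertible when `E' E` is close to
`1`, and equals `1` where `E' = E`, so the frame over the smaller ball is kept. -/
lemma IsFrame.extend_small (hEc : Continuous E) (hE : ∀ ω, E ω * E ω = 1) {r r' : ℝ}
    (hr : 0 ≤ r) (hrr' : r ≤ r')
    (hclose : ∀ ω, ‖E (retract r' ω) * E (retract r ω) - 1‖ < 1)
    {V : Space s → Matrix (Fin n) (Fin n) ℂ} (hV : IsFrame E D r V) :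
    ∃ V', IsFrame E D r' V' ∧ ∀ ω, ‖ω‖ ≤ r → V' ω = V ω := by
  let W : Space s → Matrix (Fin n) (Fin n) ℂ := fun ω =>
    (1 / 2 : ℂ) • (1 + E (retract r' ω) * E (retract r ω))
  have hWE : ∀ ω, E (retract r' ω) * W ω = W ω * E (retract r ω) := fun ω => by
    simp only [W, Matrix.mul_smul, Matrix.smul_mul, mul_add, add_mul, mul_one, one_mul]
    rw [← mul_assoc, hE, mul_assoc, hE, one_mul, mul_one, add_comm]
  have hWu : ∀ ω, IsUnit (W ω) := fun ω => by
    have h1 : W ω = 1 - (1 / 2 : ℂ) • (1 - E (retract r' ω) * E (retract r ω)) := by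
      simp only [W, smul_add, smul_sub]
      rw [sub_sub_eq_add_sub, add_sub_right_comm]
      congr 1
      have : (1 : Matrix (Fin n) (Fin n) ℂ) = (1 / 2 : ℂ) • 1 + (1 / 2 : ℂ) • 1 := by
        rw [← add_smul]; norm_num
      nth_rewrite 2 [this]
      rw [add_sub_cancel_right]
    rw [h1]
    refine isUnit_one_sub_of_norm_lt_one ?_
    rw [norm_smul, norm_sub_rev]
    have := hclose ω
    norm_num
    linarith [norm_nonneg (E (retract r' ω) * E (retract r ω) - 1)]
  have hr' := hr.trans hrr'
  refine ⟨fun ω => W ω * V ω, ⟨?_, fun ω => (hWu ω).mul (hV.isUnit ω), fun ω => ?_⟩, fun ω h => ?_⟩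
  · refine Continuous.mul ?_ hV.continuous
    have h1 := hEc.comp (continuous_retract (s := s) hr')
    have h2 := hEc.comp (continuous_retract (s := s) hr)
    exact (continuous_const.add (h1.mul h2)).const_smul (1 / 2 : ℂ)
  · rw [← mul_assoc, hWE, mul_assoc, hV.intertwines, mul_assoc]
  · simp only [W]
    rw [retract_of_norm_le hr h, retract_of_norm_le hr' (h.trans hrr'), hE, ← two_smul ℂ, smul_smul]
    norm_num

lemma IsFrame.extend (hEc : Continuous E) (hE : ∀ ω, E ω * E ω = 1) (k : ℕ)
    {V : Space s → Matrix (Fin n) (Fin n) ℂ} (hV : IsFrame E D k V) :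
    ∃ V', IsFrame E D (k + 1 : ℕ) V' ∧ ∀ ω, ‖ω‖ ≤ k → V' ω = V ω := by
  let K := Metric.closedBall (0 : Space s) (k + 1)
  have hK : IsCompact (K ×ˢ K) := (isCompact_closedBall _ _).prod (isCompact_closedBall _ _)
  have hfc : Continuous fun q : Space s × Space s => E q.1 * E q.2 - 1 :=
    ((hEc.comp continuous_fst).mul (hEc.comp continuous_snd)).sub continuous_const
  obtain ⟨δ, hδ, hclose⟩ := Metric.uniformContinuousOn_iff.1
    (hK.uniformContinuousOn_of_continuous hfc.continuousOn) 1 one_pos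
  obtain ⟨N, hN⟩ := exists_nat_one_div_lt hδ
  have hN0 : (0 : ℝ) < (N : ℝ) + 1 := by positivity
  -- The radius grows from `k` to `k + 1` in `N + 1` equal steps, each shorter than the modulus `δ`
  -- of uniform continuity on the larger ball.
  have key : ∀ j : ℕ, j ≤ N + 1 → ∃ V', IsFrame E D (k + j / ((N : ℝ) + 1)) V' ∧
      ∀ ω, ‖ω‖ ≤ k → V' ω = V ω := by
    intro j
    induction j with
    | zero => exact fun _ => ⟨V, by simpa using hV, fun _ _ => rfl⟩
    | succ j ih =>
      intro hj
      obtain ⟨V₁, hV₁, h₁⟩ := ih (by omega)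
      have e : (k : ℝ) + ((j + 1 : ℕ) : ℝ) / ((N : ℝ) + 1) =
          k + j / ((N : ℝ) + 1) + 1 / ((N : ℝ) + 1) := by
        push_cast; ring
      have hpos : 0 < 1 / ((N : ℝ) + 1) := by positivity
      have hle : (k : ℝ) + ((j + 1 : ℕ) : ℝ) / ((N : ℝ) + 1) ≤ k + 1 := by
        have : ((j + 1 : ℕ) : ℝ) ≤ (N : ℝ) + 1 := by exact_mod_cast hj
        have := (div_le_one hN0).2 this
        linarith
      have h0 : (0 : ℝ) ≤ k + j / ((N : ℝ) + 1) := by positivity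
      obtain ⟨V₂, hV₂, h₂⟩ := hV₁.extend_small (r' := (k : ℝ) + ((j + 1 : ℕ) : ℝ) / ((N : ℝ) + 1))
        hEc hE h0 (by linarith) fun ω => by
          have hm : retract (k + j / ((N : ℝ) + 1)) ω ∈ K :=
            mem_closedBall_zero_iff.2 ((norm_retract_le h0 ω).trans (by linarith))
          have hm' : retract ((k : ℝ) + ((j + 1 : ℕ) : ℝ) / ((N : ℝ) + 1)) ω ∈ K :=
            mem_closedBall_zero_iff.2 ((norm_retract_le (by linarith) ω).trans hle)
          have hd := dist_retract_le h0 (r' := (k : ℝ) + ((j + 1 : ℕ) : ℝ) / ((N : ℝ) + 1))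
            (by linarith) ω
          -- The comparison point lies on the diagonal, where `E E - 1` vanishes, so closeness of
          -- values becomes the norm bound required for one step.
          have := hclose (_, _) ⟨hm', hm⟩ (_, _) ⟨hm, hm⟩ (by
            rw [Prod.dist_eq, dist_self]
            exact max_lt (hd.trans_lt (by linarith)) hδ)
          rwa [hE, sub_self, dist_zero_right] at this
      refine ⟨V₂, hV₂, fun ω hω => (h₂ ω (hω.trans ?_)).trans (h₁ ω hω)⟩
      have : (0 : ℝ) ≤ j / ((N : ℝ) + 1) := by positivity
      linarith
  obtain ⟨V', hV', h'⟩ := key (N + 1) le_rfl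
  refine ⟨V', ?_, h'⟩
  have e : (k : ℝ) + ((N + 1 : ℕ) : ℝ) / ((N : ℝ) + 1) = (k + 1 : ℕ) := by
    push_cast
    rw [div_self hN0.ne']
  rwa [e] at hV'

/-- A continuous family of involutions over `ℝ^s` is diagonalized by a continuous frame. -/
lemma exists_continuous_frame (hEc : Continuous E) (hE : ∀ ω, E ω * E ω = 1) :
    ∃ n₁ n₂ : ℕ, n₁ + n₂ = n ∧ ∃ V : Space s → Matrix (Fin n) (Fin n) ℂ, Continuous V ∧
      (∀ ω, IsUnit (V ω)) ∧ ∀ ω, E ω * V ω = V ω * signature n n₁ := by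
  -- The signature is read off at the origin; transport intertwines with the same diagonal matrix,
  -- so it serves for all frequencies.
  obtain ⟨n₁, n₂, hn, V₀, hV₀, h₀⟩ := exists_signature_of_involution (hE 0)
  refine ⟨n₁, n₂, hn, ?_⟩
  have hbase : IsFrame E (signature n n₁) (0 : ℕ) fun _ => V₀ :=
    ⟨continuous_const, fun _ => hV₀, fun ω => by rw [Nat.cast_zero, retract_zero]; exact h₀⟩
  choose! next hnext hagree using fun (k : ℕ) (V : Space s → Matrix (Fin n) (Fin n) ℂ)
    (hV : IsFrame E (signature n n₁) k V) => hV.extend hEc hE k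
  let F : ℕ → Space s → Matrix (Fin n) (Fin n) ℂ := fun k => Nat.rec (fun _ => V₀) next k
  have hF : ∀ k : ℕ, IsFrame E (signature n n₁) k (F k) := fun k => by
    induction k with
    | zero => exact hbase
    | succ k ih => exact hnext k _ ih
  have hstable : ∀ (k j : ℕ) (ω : Space s), ‖ω‖ ≤ k → F (k + j) ω = F k ω := by
    intro k j ω hω
    induction j with
    | zero => rfl
    | succ j ih =>
      rw [← ih]
      exact hagree (k + j) _ (hF _) ω (hω.trans (by exact_mod_cast Nat.le_add_right k j))
  -- The index jumps with `‖ω‖`, but by stability `V` coincides with the single continuous frame `F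
  -- k` on the whole ball of radius `k`.
  let V : Space s → Matrix (Fin n) (Fin n) ℂ := fun ω => F ⌈‖ω‖⌉₊ ω
  have hV : ∀ (k : ℕ) (ω : Space s), ‖ω‖ ≤ k → V ω = F k ω := fun k ω h => by
    obtain ⟨j, rfl⟩ := Nat.exists_eq_add_of_le (Nat.ceil_le.2 h)
    exact (hstable _ j ω (Nat.le_ceil _)).symm
  refine ⟨V, continuous_iff_continuousAt.2 fun ω => ?_, fun ω => (hF _).isUnit ω, fun ω => ?_⟩
  · obtain ⟨k, hk⟩ := exists_nat_gt ‖ω‖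
    refine (hF k).continuous.continuousAt.congr ?_
    filter_upwards [continuous_norm.continuousAt.eventually_lt continuousAt_const hk] with ω' h
    exact (hV k ω' h.le).symm
  · have := (hF ⌈‖ω‖⌉₊).intertwines ω
    rwa [retract_of_norm_le (Nat.cast_nonneg _) (Nat.le_ceil _)] at this

end Frames
-- Simultaneous normal form of `S` and `Q`, and block decomposition of multipliers.
section NormalForm
open scoped Matrix.Norms.L2Operator

variable {s n m p : ℕ}

lemma continuous_matrix_inv {X : Type*} [TopologicalSpace X] {A : X → Matrix (Fin n) (Fin n) ℂ}
    (hA : Continuous A) (hu : ∀ x, IsUnit (A x)) : Continuous fun x => (A x)⁻¹ := by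
  simp only [Matrix.nonsing_inv_eq_ringInverse]
  refine continuous_iff_continuousAt.2 fun x => ?_
  obtain ⟨u, h⟩ := hu x
  have h1 := NormedRing.inverse_continuousAt u
  rw [h] at h1
  exact ContinuousAt.comp (f := A) h1 hA.continuousAt

/-- Simultaneous continuous congruence of `Q` to the identity and of `S` to a signature matrix. -/
lemma exists_normalForm {S Q : Space s → Matrix (Fin n) (Fin n) ℂ}
    (hSc : Continuous S) (hQc : Continuous Q) (hSu : ∀ ω, IsUnit (S ω)) (hQu : ∀ ω, IsUnit (Q ω))
    (hSh : ∀ ω, (S ω).IsHermitian) (hQ : ∀ ω, (Q ω).PosDef)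
    (hcompat : ∀ ω, Q ω = S ω * (Q ω)⁻¹ * S ω) :
    ∃ n₁ n₂ : ℕ, n₁ + n₂ = n ∧ ∃ H : Space s → Matrix (Fin n) (Fin n) ℂ, Continuous H ∧
      (∀ ω, IsUnit (H ω)) ∧ (∀ ω, (H ω)ᴴ * H ω = Q ω) ∧
      ∀ ω, (H ω)ᴴ * signature n n₁ * H ω = S ω := by
  have hSd := fun ω => (Matrix.isUnit_iff_isUnit_det _).1 (hSu ω)
  have hQd := fun ω => (Matrix.isUnit_iff_isUnit_det _).1 (hQu ω)
  have hE : ∀ ω, ((S ω)⁻¹ * Q ω) * ((S ω)⁻¹ * Q ω) = 1 := fun ω => by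
    nth_rewrite 1 [hcompat ω]
    rw [mul_assoc (S ω), Matrix.nonsing_inv_mul_cancel_left _ _ (hSd ω), ← mul_assoc,
      Matrix.mul_nonsing_inv_cancel_right _ _ (hSd ω), Matrix.nonsing_inv_mul _ (hQd ω)]
  obtain ⟨n₁, n₂, hn, V, hVc, hVu, hV⟩ := exists_continuous_frame
    (E := fun ω => (S ω)⁻¹ * Q ω) ((continuous_matrix_inv hSc hSu).mul hQc) hE
  have hVd := fun ω => (Matrix.isUnit_iff_isUnit_det _).1 (hVu ω)
  have hQV : ∀ ω, Q ω * V ω = S ω * V ω * signature n n₁ := fun ω => by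
    rw [mul_assoc (S ω), ← hV, ← mul_assoc, Matrix.mul_nonsing_inv_cancel_left _ _ (hSd ω)]
  set M : Space s → Matrix (Fin n) (Fin n) ℂ := fun ω => (V ω)ᴴ * Q ω * V ω with hM
  have hMp : ∀ ω, (M ω).PosSemidef := fun ω =>
    (hQ ω).posSemidef.conjTranspose_mul_mul_same (V ω)
  have hMc : Continuous M := (hVc.matrix_conjTranspose.mul hQc).mul hVc
  obtain ⟨R, hRc, hR⟩ := exists_continuous_sqrt hMc (fun ω => (hMp ω).1)
    fun ω z hz => (Matrix.posSemidef_iff_isHermitian_and_spectrum_nonneg.1 (hMp ω)).2 hz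
  have hMS : ∀ ω, M ω * signature n n₁ = (V ω)ᴴ * S ω * V ω := fun ω => by
    simp only [hM]
    rw [mul_assoc (V ω)ᴴ, hQV, ← mul_assoc, mul_assoc _ _ (signature n n₁), signature_mul_self,
      mul_one, mul_assoc]
  -- A product of two Hermitian matrices that is Hermitian forces them to commute; here the product
  -- is `V* S V`.
  have hcomm : ∀ ω, Commute (M ω) (signature n n₁) := fun ω => by
    have h : (M ω * signature n n₁)ᴴ = M ω * signature n n₁ := by
      rw [hMS, Matrix.conjTranspose_mul, Matrix.conjTranspose_mul, (hSh ω).eq,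
        Matrix.conjTranspose_conjTranspose, mul_assoc]
    have hMh : (M ω)ᴴ = M ω := (hMp ω).1
    rw [Matrix.conjTranspose_mul, conjTranspose_signature, hMh] at h
    exact h.symm
  have hRu : ∀ ω, IsUnit (R ω) := fun ω => by
    have hMu : IsUnit (M ω) := ((hVu ω).star.mul (hQu ω)).mul (hVu ω)
    rw [← (hR ω).2.1] at hMu
    exact isUnit_of_mul_isUnit_left hMu
  have hVi : ∀ ω, V ω * (V ω)⁻¹ = 1 := fun ω => Matrix.mul_nonsing_inv _ (hVd ω)
  have hVi' : ∀ ω, ((V ω)⁻¹)ᴴ * (V ω)ᴴ = 1 := fun ω => by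
    rw [← Matrix.conjTranspose_mul, hVi, Matrix.conjTranspose_one]
  have hRh : ∀ ω, (R ω)ᴴ = R ω := fun ω => (hR ω).1
  -- The columns of `V` already diagonalize `S⁻¹ Q`; the factor `R = M^(1/2)` normalizes their Gram
  -- matrix with respect to `Q` without disturbing the signature, since it commutes with it.
  refine ⟨n₁, n₂, hn, fun ω => R ω * (V ω)⁻¹, hRc.mul (continuous_matrix_inv hVc hVu),
    fun ω => (hRu ω).mul (Matrix.isUnit_nonsing_inv_iff.2 (hVu ω)), fun ω => ?_, fun ω => ?_⟩
  · calc (R ω * (V ω)⁻¹)ᴴ * (R ω * (V ω)⁻¹) = ((V ω)⁻¹)ᴴ * (R ω * R ω) * (V ω)⁻¹ := by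
          rw [Matrix.conjTranspose_mul, hRh]; simp only [mul_assoc]
      _ = (((V ω)⁻¹)ᴴ * (V ω)ᴴ) * Q ω * (V ω * (V ω)⁻¹) := by
          rw [(hR ω).2.1]; simp only [hM, mul_assoc]
      _ = Q ω := by rw [hVi, hVi', one_mul, mul_one]
  · calc (R ω * (V ω)⁻¹)ᴴ * signature n n₁ * (R ω * (V ω)⁻¹)
        = ((V ω)⁻¹)ᴴ * (R ω * (signature n n₁ * R ω)) * (V ω)⁻¹ := by
          rw [Matrix.conjTranspose_mul, hRh]; simp only [mul_assoc]
      _ = ((V ω)⁻¹)ᴴ * (R ω * R ω * signature n n₁) * (V ω)⁻¹ := by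
          rw [← ((hR ω).2.2 _ (hcomm ω)).eq, mul_assoc (R ω)]
      _ = (((V ω)⁻¹)ᴴ * (V ω)ᴴ) * S ω * (V ω * (V ω)⁻¹) := by
          rw [(hR ω).2.1, hMS]; simp only [mul_assoc]
      _ = S ω := by rw [hVi, hVi', one_mul, mul_one]

/-! ### Block decomposition -/

lemma fourier_proj₁ {n₁ n₂ : ℕ} (h : n₁ + n₂ = n) (f : L2 s n) :
    ((𝓕 (proj₁ s h f) : L2 s n₁) : Space s → _) =ᵐ[volume] fun ξ =>
      WithLp.toLp 2 fun i => (𝓕 f : L2 s n) ξ (Fin.cast h (Fin.castAdd n₂ i)) := by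
  rw [proj₁, fourier_compLpL]
  exact ContinuousLinearMap.coeFn_compLpL _ _

lemma fourier_proj₂ {n₁ n₂ : ℕ} (h : n₁ + n₂ = n) (f : L2 s n) :
    ((𝓕 (proj₂ s h f) : L2 s n₂) : Space s → _) =ᵐ[volume] fun ξ =>
      WithLp.toLp 2 fun i => (𝓕 f : L2 s n) ξ (Fin.cast h (Fin.natAdd n₁ i)) := by
  rw [proj₂, fourier_compLpL]
  exact ContinuousLinearMap.coeFn_compLpL _ _

lemma fourier_incl₁ {n₁ n₂ : ℕ} (h : n₁ + n₂ = n) (f : L2 s n₁) :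
    ((𝓕 (incl₁ s h f) : L2 s n) : Space s → _) =ᵐ[volume] fun ξ =>
      WithLp.toLp 2 fun i => Fin.append (WithLp.ofLp ((𝓕 f : L2 s n₁) ξ)) (0 : Fin n₂ → ℂ)
        (Fin.cast h.symm i) := by
  rw [incl₁, fourier_compLpL]
  exact ContinuousLinearMap.coeFn_compLpL _ _

lemma fourier_incl₂ {n₁ n₂ : ℕ} (h : n₁ + n₂ = n) (f : L2 s n₂) :
    ((𝓕 (incl₂ s h f) : L2 s n) : Space s → _) =ᵐ[volume] fun ξ =>
      WithLp.toLp 2 fun i => Fin.append (0 : Fin n₁ → ℂ) (WithLp.ofLp ((𝓕 f : L2 s n₂) ξ))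
        (Fin.cast h.symm i) := by
  rw [incl₂, fourier_compLpL]
  exact ContinuousLinearMap.coeFn_compLpL _ _

lemma proj₁_cutoffOp {n₁ n₂ : ℕ} (h : n₁ + n₂ = n) (k : ℕ) (f : L2 s n) :
    proj₁ s h (cutoffOp s n k f) = cutoffOp s n₁ k (proj₁ s h f) := by
  refine ext_fourier ?_
  filter_upwards [fourier_proj₁ h (cutoffOp s n k f), fourier_cutoffOp k f,
    fourier_cutoffOp k (proj₁ s h f), fourier_proj₁ h f] with ξ h1 h2 h3 h4
  rw [h1, h2, h3, h4]
  rfl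

lemma proj₂_cutoffOp {n₁ n₂ : ℕ} (h : n₁ + n₂ = n) (k : ℕ) (f : L2 s n) :
    proj₂ s h (cutoffOp s n k f) = cutoffOp s n₂ k (proj₂ s h f) := by
  refine ext_fourier ?_
  filter_upwards [fourier_proj₂ h (cutoffOp s n k f), fourier_cutoffOp k f,
    fourier_cutoffOp k (proj₂ s h f), fourier_proj₂ h f] with ξ h1 h2 h3 h4
  rw [h1, h2, h3, h4]
  rfl

/-- The diagonal and off-diagonal blocks of a matrix, selected by two families of indices. -/
abbrev blockOf {k l : ℕ} (e : Fin k → Fin n) (e' : Fin l → Fin n)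
    (a : Space s → Matrix (Fin n) (Fin n) ℂ) : Space s → Matrix (Fin k) (Fin l) ℂ :=
  fun ω => (a ω).submatrix e e'

/-- The first `n₁` indices. -/
abbrev fst {n₁ n₂ : ℕ} (h : n₁ + n₂ = n) (i : Fin n₁) : Fin n := Fin.cast h (Fin.castAdd n₂ i)

/-- The last `n₂` indices. -/
abbrev snd {n₁ n₂ : ℕ} (h : n₁ + n₂ = n) (i : Fin n₂) : Fin n := Fin.cast h (Fin.natAdd n₁ i)

lemma block_le_multiplier {n₁ n₂ : ℕ} (h : n₁ + n₂ = n) (a : Space s → Matrix (Fin n) (Fin n) ℂ) :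
    block h (multiplier (blockOf (fst h) (fst h) a)) (multiplier (blockOf (fst h) (snd h) a))
      (multiplier (blockOf (snd h) (fst h) a)) (multiplier (blockOf (snd h) (snd h) a)) ≤
      multiplier a := by
  refine LinearPMap.le_of_le_graph ?_
  rintro ⟨z, w⟩ hzw
  obtain ⟨z, rfl, rfl⟩ := (LinearPMap.mem_graph_iff _).1 hzw
  rw [mem_graph_multiplier]
  obtain ⟨z, ⟨h11, h21⟩, h12, h22⟩ := z
  set y₁ := multiplier (blockOf (fst h) (fst h) a) ⟨proj₁ s h z, h11⟩ with hy₁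
  set y₂ := multiplier (blockOf (fst h) (snd h) a) ⟨proj₂ s h z, h12⟩ with hy₂
  set y₃ := multiplier (blockOf (snd h) (fst h) a) ⟨proj₁ s h z, h21⟩ with hy₃
  set y₄ := multiplier (blockOf (snd h) (snd h) a) ⟨proj₂ s h z, h22⟩ with hy₄
  change ((𝓕 (incl₁ s h (y₁ + y₂) + incl₂ s h (y₃ + y₄)) : L2 s n) : Space s → _) =ᵐ[volume] _
  have e : (𝓕 (incl₁ s h (y₁ + y₂) + incl₂ s h (y₃ + y₄)) : L2 s n) =
      𝓕 (incl₁ s h (y₁ + y₂)) + 𝓕 (incl₂ s h (y₃ + y₄)) := FourierTransform.fourier_add _ _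
  have e₁ : (𝓕 (y₁ + y₂) : L2 s n₁) = 𝓕 y₁ + 𝓕 y₂ := FourierTransform.fourier_add _ _
  have e₂ : (𝓕 (y₃ + y₄) : L2 s n₂) = 𝓕 y₃ + 𝓕 y₄ := FourierTransform.fourier_add _ _
  rw [e]
  filter_upwards [Lp.coeFn_add (𝓕 (incl₁ s h (y₁ + y₂)) : L2 s n) (𝓕 (incl₂ s h (y₃ + y₄))),
    fourier_incl₁ h (y₁ + y₂), fourier_incl₂ h (y₃ + y₄),
    Lp.coeFn_add (𝓕 y₁ : L2 s n₁) (𝓕 y₂), Lp.coeFn_add (𝓕 y₃ : L2 s n₂) (𝓕 y₄),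
    fourier_multiplier _ ⟨proj₁ s h z, h11⟩, fourier_multiplier _ ⟨proj₂ s h z, h12⟩,
    fourier_multiplier _ ⟨proj₁ s h z, h21⟩, fourier_multiplier _ ⟨proj₂ s h z, h22⟩,
    fourier_proj₁ h z, fourier_proj₂ h z] with ξ g g₁ g₂ k₁ k₂ m₁ m₂ m₃ m₄ q₁ q₂
  rw [g, Pi.add_apply, g₁, g₂, e₁, e₂, k₁, k₂, Pi.add_apply, Pi.add_apply, hy₁, hy₂, hy₃, hy₄,
    m₁, m₂, m₃, m₄]
  simp only [symbolMul, q₁, q₂]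
  subst h
  ext i
  refine Fin.addCases (fun j => ?_) (fun j => ?_) i
  · simp [Matrix.mulVec, dotProduct, Fin.sum_univ_add]
  · simp [Matrix.mulVec, dotProduct, Fin.sum_univ_add]

lemma cutoffOp_mem_graph {a : Space s → Matrix (Fin m) (Fin n) ℂ} (k : ℕ) {z : L2 s n}
    {w : L2 s m} (h : (z, w) ∈ (multiplier a).graph) :
    (cutoffOp s n k z, cutoffOp s m k w) ∈ (multiplier a).graph := by
  rw [mem_graph_multiplier] at h ⊢
  filter_upwards [h, fourier_cutoffOp k w, symbolMul_cutoffOp a k z] with ξ h1 h2 h3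
  rw [h2, h1, h3]
  simp only [symbolMul, Matrix.smul_mulVec, WithLp.toLp_smul]

/-- The natural domain of the block matrix can be smaller than that of the multiplier, because
cancellation between blocks is lost. It still contains all frequency cut-offs, and these approximate
every point of the graph, so it is a core. -/
lemma closure_block {n₁ n₂ : ℕ} (h : n₁ + n₂ = n) {a : Space s → Matrix (Fin n) (Fin n) ℂ}
    (ha : Continuous a) :
    (block h (multiplier (blockOf (fst h) (fst h) a)) (multiplier (blockOf (fst h) (snd h) a))
      (multiplier (blockOf (snd h) (fst h) a)) (multiplier (blockOf (snd h) (snd h) a))).closure =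
      multiplier a := by
  have hle := block_le_multiplier h a
  have hcl := isClosed_multiplier ha
  refine LinearPMap.eq_of_eq_graph ?_
  rw [← (hcl.isClosable.leIsClosable hle).graph_closure_eq_closure_graph]
  refine le_antisymm (Submodule.topologicalClosure_minimal _ (LinearPMap.le_graph_of_le hle) hcl) ?_
  rintro ⟨z, w⟩ hzw
  refine mem_closure_of_tendsto ((tendsto_cutoffOp z).prodMk_nhds (tendsto_cutoffOp w))
    (.of_forall fun k => ?_)
  have hmem : cutoffOp s n k z ∈ (block h (multiplier (blockOf (fst h) (fst h) a))
      (multiplier (blockOf (fst h) (snd h) a)) (multiplier (blockOf (snd h) (fst h) a))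
      (multiplier (blockOf (snd h) (snd h) a))).domain := by
    refine ⟨⟨?_, ?_⟩, ?_, ?_⟩
    · change proj₁ s h (cutoffOp s n k z) ∈ _
      rw [proj₁_cutoffOp]
      exact cutoffOp_mem_domain (ha.matrix_submatrix _ _) k _
    · change proj₁ s h (cutoffOp s n k z) ∈ _
      rw [proj₁_cutoffOp]
      exact cutoffOp_mem_domain (ha.matrix_submatrix _ _) k _
    · change proj₂ s h (cutoffOp s n k z) ∈ _
      rw [proj₂_cutoffOp]
      exact cutoffOp_mem_domain (ha.matrix_submatrix _ _) k _
    · change proj₂ s h (cutoffOp s n k z) ∈ _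
      rw [proj₂_cutoffOp]
      exact cutoffOp_mem_domain (ha.matrix_submatrix _ _) k _
  have h1 := LinearPMap.mem_graph _ (⟨_, hmem⟩ : (block h _ _ _ _).domain)
  -- Cut-offs commute with the multiplier, so the block matrix sends the cut-off of `z` to the
  -- cut-off of `w`.
  have h2 := LinearPMap.mem_graph_snd_inj _ (LinearPMap.le_graph_of_le hle h1)
    (cutoffOp_mem_graph k hzw) rfl
  rw [h2] at h1
  exact h1

lemma isNonpositive_multiplier {a : Space s → Matrix (Fin n) (Fin n) ℂ} (ha : Continuous a)
    (hh : ∀ ω, (a ω)ᴴ = a ω) (hd : ∀ ω, (-((a ω)ᴴ + a ω)).PosSemidef) :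
    IsNonpositive (multiplier a) := by
  refine ⟨dense_multiplier_domain ha, ?_, fun z => ?_⟩
  · rw [multiplier_adjoint ha]
    simp only [hh]
  · rw [inner_eq_inner_fourier, L2.inner_def]
    have hi := L2.integrable_inner (𝕜 := ℂ) (𝓕 (multiplier a z) : L2 s n) (𝓕 (z : L2 s n))
    have h1 := integral_re hi
    simp only [RCLike.re_to_complex] at h1
    rw [← h1]
    refine integral_nonpos_of_ae ?_
    filter_upwards [fourier_multiplier a z] with ξ h
    rw [h]
    exact re_inner_mulVec_nonpos (hd _) _

end NormalForm
-- The collocated realization, its self-duality and its block structure.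
section Realization
open scoped Matrix.Norms.L2Operator

variable {s n m p : ℕ}

lemma isContractive_semigroup {a : Space s → Matrix (Fin n) (Fin n) ℂ} (ha : Continuous a)
    (hd : ∀ ω, (-((a ω)ᴴ + a ω)).PosSemidef) : (semigroup ha hd).IsContractive :=
  ⟨continuous_semigroupOp ha hd, norm_semigroupOp_le ha hd⟩

/-- The collocated system with state symbol `a`, input symbol `b` and output symbol `b*`. -/
def collocatedSystem {a : Space s → Matrix (Fin n) (Fin n) ℂ} (ha : Continuous a)
    {b : Space s → Matrix (Fin n) (Fin m) ℂ} (hb : Continuous b) {K : ℝ} (hK : ∀ ω, ‖b ω‖ ≤ K) :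
    System s m n m where
  A := multiplier a
  B := boundedMultiplier b hb K hK
  C := (boundedMultiplier b hb K hK).adjoint
  dense_domain := dense_multiplier_domain ha
  invariant_A := isTranslationInvariant_multiplier a
  invariant_B := by
    rw [everywhere_boundedMultiplier]
    exact isTranslationInvariant_multiplier _
  invariant_C := by
    rw [boundedMultiplier_adjoint hb hK fun ω => (Matrix.l2_opNorm_conjTranspose _).trans_le (hK ω),
      everywhere_boundedMultiplier]
    exact isTranslationInvariant_multiplier _
  symA := a
  symB := b
  symC := fun ω => (b ω)ᴴ
  continuous_symA := ha
  continuous_symB := hb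
  continuous_symC := hb.matrix_conjTranspose
  hasSymbol_A := hasFourierSymbol_multiplier a
  hasSymbol_B := by
    rw [everywhere_boundedMultiplier]
    exact hasFourierSymbol_multiplier _
  hasSymbol_C := by
    rw [boundedMultiplier_adjoint hb hK fun ω => (Matrix.l2_opNorm_conjTranspose _).trans_le (hK ω),
      everywhere_boundedMultiplier]
    exact hasFourierSymbol_multiplier _

section
variable {a : Space s → Matrix (Fin n) (Fin n) ℂ} (ha : Continuous a)
    {b : Space s → Matrix (Fin n) (Fin m) ℂ} (hb : Continuous b) {K : ℝ} (hK : ∀ ω, ‖b ω‖ ≤ K)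
    (hd : ∀ ω, (-((a ω)ᴴ + a ω)).PosSemidef)

lemma fourier_collocatedSystem_C (f : L2 s n) :
    ((𝓕 ((collocatedSystem ha hb hK).C f) : L2 s m) : Space s → _) =ᵐ[volume]
      symbolMul (fun ω => (b ω)ᴴ) f := by
  have hC : (collocatedSystem ha hb hK).C = _ :=
    boundedMultiplier_adjoint hb hK fun ω => (Matrix.l2_opNorm_conjTranspose _).trans_le (hK ω)
  rw [hC]
  exact fourier_boundedMultiplier _ _ _

lemma collocatedSystem_response {t : ℝ} (ht : 0 ≤ t) :
    everywhere (((collocatedSystem ha hb hK).C.comp ((semigroup ha hd).op t)).comp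
      (collocatedSystem ha hb hK).B) =
      multiplier fun ω => (b ω)ᴴ * NormedSpace.exp (t • a ω) * b ω := by
  refine everywhere_eq_multiplier fun f => ?_
  filter_upwards [fourier_boundedMultiplier hb hK f,
    fourier_semigroupOp ha hd t ((collocatedSystem ha hb hK).B f),
    fourier_collocatedSystem_C ha hb hK
      ((semigroup ha hd).op t ((collocatedSystem ha hb hK).B f))] with ξ h1 h2 h3
  change ((𝓕 ((collocatedSystem ha hb hK).C ((semigroup ha hd).op t
    ((collocatedSystem ha hb hK).B f))) : L2 s m)) ξ = _
  have h2' : (𝓕 ((semigroup ha hd).op t ((collocatedSystem ha hb hK).B f)) : L2 s n) ξ = _ := h2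
  have h1' : (𝓕 ((collocatedSystem ha hb hK).B f) : L2 s n) ξ = _ := h1
  rw [h3]
  simp only [symbolMul, h2', flow, h1', max_eq_left ht, rescale, Matrix.mulVec_mulVec,
    Matrix.mul_assoc]

/-- Multiplication by the signature matrix, as an automorphism of `L₂`. -/
def signatureEquiv (s n k : ℕ) : L2 s n ≃L[ℂ] L2 s n :=
  let D := boundedMultiplier (s := s) (fun _ => signature n k) continuous_const ‖signature n k‖
    fun _ => le_rfl
  have hD : ∀ f, D (D f) = f := fun f => by
    refine ext_fourier ?_
    filter_upwards [fourier_boundedMultiplier (s := s) (b := fun _ => signature n k)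
      continuous_const (fun _ => le_rfl) (D f), symbolMul_boundedMultiplier (s := s)
      (fun _ => signature n k) (b := fun _ => signature n k) continuous_const (fun _ => le_rfl) f]
      with ξ h1 h2
    rw [h1, h2]
    simp [symbolMul, signature_mul_self]
  ContinuousLinearEquiv.equivOfInverse D D hD hD

lemma fourier_signatureEquiv (k : ℕ) (f : L2 s n) :
    ((𝓕 (signatureEquiv s n k f) : L2 s n) : Space s → _) =ᵐ[volume]
      symbolMul (fun _ => signature n k) f :=
  fourier_boundedMultiplier (s := s) (b := fun _ => signature n k) continuous_const
    (fun _ => le_rfl) f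

/-- The isomorphism is multiplication by the constant signature matrix, which is self-adjoint and
its own inverse, hence bounded both ways. -/
lemma collocatedSystem_isSelfDual {k : ℕ} (hsa : ∀ ω, (a ω)ᴴ * signature n k = signature n k * a ω)
    (hsb : ∀ ω, signature n k * b ω = b ω) : (collocatedSystem ha hb hK).IsSelfDual := by
  have hDB : ((signatureEquiv s n k : L2 s n →L[ℂ] L2 s n)).comp (boundedMultiplier b hb K hK) =
      boundedMultiplier b hb K hK := by
    ext1 f
    refine ext_fourier ?_
    filter_upwards [fourier_signatureEquiv k (boundedMultiplier b hb K hK f),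
      fourier_boundedMultiplier hb hK f, symbolMul_boundedMultiplier (fun _ => signature n k)
      hb hK f] with ξ h1 h2 h3
    rw [h2]
    refine (h1.trans h3).trans ?_
    simp only [hsb]
  refine ⟨signatureEquiv s n k, ?_, fun z w => ?_, ?_, ?_⟩
  · have e : everywhere (signatureEquiv s n k : L2 s n →L[ℂ] L2 s n) = _ :=
      everywhere_eq_multiplier (fun f => fourier_signatureEquiv k f)
    rw [e]
    exact isTranslationInvariant_multiplier _
  · change _ ∈ (multiplier a).graph ↔ _ ∈ ((multiplier a)†).graph
    rw [multiplier_adjoint ha, mem_graph_multiplier, mem_graph_multiplier]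
    have hz := fourier_signatureEquiv k z
    have hw := fourier_signatureEquiv k w
    constructor
    · intro h
      filter_upwards [hz, hw, h] with ξ h1 h2 h3
      rw [h2]
      simp only [symbolMul, h1, h3, Matrix.mulVec_mulVec, hsa]
    · intro h
      filter_upwards [hz, hw, h] with ξ h1 h2 h3
      rw [h2] at h3
      simp only [symbolMul, h1, Matrix.mulVec_mulVec, hsa] at h3
      -- Multiplying by the signature once more undoes it, which gives the inclusion of domains in
      -- the other direction.
      have h4 := congrArg (fun x : EuclideanSpace ℂ (Fin n) =>
        (WithLp.toLp 2 (signature n k *ᵥ WithLp.ofLp x) : EuclideanSpace ℂ (Fin n))) h3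
      simp only [Matrix.mulVec_mulVec, ← mul_assoc, signature_mul_self, Matrix.one_mulVec, one_mul,
        WithLp.toLp_ofLp] at h4
      exact h4
  · change _ = ((boundedMultiplier b hb K hK).adjoint).adjoint
    rw [ContinuousLinearMap.adjoint_adjoint]
    exact hDB
  · change ((boundedMultiplier b hb K hK).adjoint).comp _ = (boundedMultiplier b hb K hK).adjoint
    have hsymm : ((signatureEquiv s n k : L2 s n →L[ℂ] L2 s n)).adjoint =
        (signatureEquiv s n k : L2 s n →L[ℂ] L2 s n) := by
      refine (boundedMultiplier_adjoint (s := s) (b := fun _ => signature n k) continuous_const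
        (fun _ => le_rfl) (C' := ‖signature n k‖) fun _ =>
          (Matrix.l2_opNorm_conjTranspose _).le).trans ?_
      simp only [conjTranspose_signature]
      rfl
    rw [← hsymm, ← ContinuousLinearMap.adjoint_comp, hDB]

/-- In the last `n₂` components `σ b = b` reads `-x = x`, so they vanish. -/
lemma incl₁_proj₁_of_signature {n₁ n₂ : ℕ} (h : n₁ + n₂ = n)
    (hsb : ∀ ω, signature n n₁ * b ω = b ω) :
    boundedMultiplier b hb K hK =
      (incl₁ s h).comp ((proj₁ s h).comp (boundedMultiplier b hb K hK)) := by
  ext1 f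
  refine ext_fourier ?_
  filter_upwards [fourier_incl₁ h (proj₁ s h (boundedMultiplier b hb K hK f)),
    fourier_proj₁ h (boundedMultiplier b hb K hK f), fourier_boundedMultiplier hb hK f]
    with ξ h1 h2 h3
  rw [ContinuousLinearMap.comp_apply, ContinuousLinearMap.comp_apply, h1, h2, h3]
  have hsnd : ∀ i : Fin n₂, (symbolMul b f ξ) (snd h i) = 0 := fun i => by
    have h4 : symbolMul b f ξ =
        WithLp.toLp 2 (signature n n₁ *ᵥ WithLp.ofLp (symbolMul b f ξ)) := by
      simp only [symbolMul, Matrix.mulVec_mulVec, hsb]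
    have h5 := congrArg (fun x : EuclideanSpace ℂ (Fin n) => x (snd h i)) h4
    simp only [signature, Matrix.mulVec_diagonal] at h5
    simp only [snd, Fin.val_cast, Fin.val_natAdd] at h5
    rw [if_neg (by omega), neg_one_mul] at h5
    exact self_eq_neg.1 h5
  subst h
  ext i
  refine Fin.addCases (fun j => ?_) (fun j => ?_) i
  · simp
  · simpa using hsnd j

/-- Compare entries of `a* σ = σ a`: the signs on the two sides agree within a diagonal block and
are opposite across the blocks. -/
lemma submatrix_eq_of_signature {n₁ n₂ : ℕ} (h : n₁ + n₂ = n) {a : Matrix (Fin n) (Fin n) ℂ}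
    (hsa : aᴴ * signature n n₁ = signature n n₁ * a) :
    (a.submatrix (fst h) (fst h))ᴴ = a.submatrix (fst h) (fst h) ∧
    (a.submatrix (snd h) (snd h))ᴴ = a.submatrix (snd h) (snd h) ∧
    -(a.submatrix (fst h) (snd h))ᴴ = a.submatrix (snd h) (fst h) := by
  have key : ∀ i j, star (a j i) * (if (j : ℕ) < n₁ then (1 : ℂ) else -1) =
      (if (i : ℕ) < n₁ then (1 : ℂ) else -1) * a i j := fun i j => by
    have := congrFun (congrFun hsa i) j
    rwa [signature, Matrix.mul_diagonal, Matrix.diagonal_mul] at this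
  refine ⟨?_, ?_, ?_⟩ <;> ext i j <;>
    simp only [Matrix.conjTranspose_apply, Matrix.submatrix_apply, Matrix.neg_apply]
  · simpa using key (fst h i) (fst h j)
  · simpa using key (snd h i) (snd h j)
  · have := key (snd h i) (fst h j)
    simp only [fst, snd, Fin.val_cast, Fin.val_natAdd, Fin.val_castAdd, Fin.is_lt, if_true,
      mul_one] at this
    rw [if_neg (by omega), neg_one_mul] at this
    rw [this, neg_neg]

end

/-- The realization theorem for symbols in normal form. -/
lemma exists_realization {a : Space s → Matrix (Fin n) (Fin n) ℂ} (ha : Continuous a)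
    {b : Space s → Matrix (Fin n) (Fin m) ℂ} (hb : Continuous b) {K : ℝ} (hK : ∀ ω, ‖b ω‖ ≤ K)
    (hd : ∀ ω, (-((a ω)ᴴ + a ω)).PosSemidef) {n₁ n₂ : ℕ} (h : n₁ + n₂ = n)
    (hsa : ∀ ω, (a ω)ᴴ * signature n n₁ = signature n n₁ * a ω)
    (hsb : ∀ ω, signature n n₁ * b ω = b ω) (sys : System s m n m)
    (hresp : ∀ (t : ℝ) (ω : Space s), sys.symC ω * NormedSpace.exp (t • sys.symA ω) * sys.symB ω =
      (b ω)ᴴ * NormedSpace.exp (t • a ω) * b ω) :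
    ∃ (sys' : System s m n m) (T : C0Semigroup (L2 s n)),
      T.HasGenerator sys'.A ∧
      (∀ t : ℝ, 0 ≤ t →
        everywhere ((sys'.C.comp (T.op t)).comp sys'.B) = sys.impulseResponse t) ∧
      sys'.IsInternallyImpedancePassive T ∧
      sys'.IsSelfDual ∧
      ∃ (n₁ n₂ : ℕ) (h : n₁ + n₂ = n)
        (A₁₁ : L2 s n₁ →ₗ.[ℂ] L2 s n₁) (A₁₂ : L2 s n₂ →ₗ.[ℂ] L2 s n₁)
        (A₂₂ : L2 s n₂ →ₗ.[ℂ] L2 s n₂) (B₁ : L2 s m →L[ℂ] L2 s n₁),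
        Dense (A₁₁.domain : Set (L2 s n₁)) ∧
        Dense (A₁₂.domain : Set (L2 s n₂)) ∧
        Dense (A₂₂.domain : Set (L2 s n₂)) ∧
        IsTranslationInvariant A₁₁ ∧
        IsTranslationInvariant A₁₂ ∧
        IsTranslationInvariant A₂₂ ∧
        IsNonpositive A₁₁ ∧
        IsNonpositive A₂₂ ∧
        sys'.A = (block h A₁₁ A₁₂ (-A₁₂†) A₂₂).closure ∧
        sys'.C.adjoint = sys'.B ∧
        sys'.B = (incl₁ s h).comp B₁ := by
  have hgen : (semigroup ha hd).HasGenerator (collocatedSystem ha hb hK).A :=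
    semigroup_hasGenerator ha hd
  have hsub := fun ω => submatrix_eq_of_signature h (hsa ω)
  have h11 : Continuous (blockOf (fst h) (fst h) a) := ha.matrix_submatrix _ _
  have h12 : Continuous (blockOf (fst h) (snd h) a) := ha.matrix_submatrix _ _
  have h22 : Continuous (blockOf (snd h) (snd h) a) := ha.matrix_submatrix _ _
  refine ⟨collocatedSystem ha hb hK, semigroup ha hd, hgen, fun t ht => ?_,
    isInternallyImpedancePassive_of_isContractive hgen (isContractive_semigroup ha hd) rfl,
    collocatedSystem_isSelfDual ha hb hK hsa hsb, n₁, n₂, h,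
    multiplier (blockOf (fst h) (fst h) a), multiplier (blockOf (fst h) (snd h) a),
    multiplier (blockOf (snd h) (snd h) a), (proj₁ s h).comp (boundedMultiplier b hb K hK),
    dense_multiplier_domain h11, dense_multiplier_domain h12, dense_multiplier_domain h22,
    isTranslationInvariant_multiplier _, isTranslationInvariant_multiplier _,
    isTranslationInvariant_multiplier _,
    isNonpositive_multiplier h11 (fun ω => (hsub ω).1) fun ω => (hd ω).submatrix (fst h),
    isNonpositive_multiplier h22 (fun ω => (hsub ω).2.1) fun ω => (hd ω).submatrix (snd h),
    ?_, ContinuousLinearMap.adjoint_adjoint _, incl₁_proj₁_of_signature hb hK h hsb⟩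
  · rw [collocatedSystem_response ha hb hK hd ht, System.impulseResponse]
    simp only [hresp]
  · have h21 : -(multiplier (blockOf (fst h) (snd h) a))† =
        multiplier (blockOf (snd h) (fst h) a) := by
      rw [multiplier_adjoint h12, neg_multiplier]
      exact congrArg multiplier (funext fun ω => (hsub ω).2.2)
    rw [h21, closure_block h ha]
    rfl

/-- The `C⋆`-identity `‖b* b‖ = ‖b‖²` turns the supremum hypothesis into boundedness of the input
operator. -/
lemma norm_le_sqrt_of_conjTranspose_mul_self {b : Matrix (Fin n) (Fin m) ℂ} {K : ℝ}
    (h : ‖bᴴ * b‖ ≤ K) : ‖b‖ ≤ √K := by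
  rw [Matrix.l2_opNorm_conjTranspose_mul_self] at h
  exact Real.le_sqrt_of_sq_le (by rwa [pow_two])

end Realization

/-! ### Change of state coordinates at each frequency, and the conclusion. -/

/-- Algebra of the passage to the normal form, at a single frequency. -/
lemma normalForm_symbols {n m k : ℕ} {A H S Q : Matrix (Fin n) (Fin n) ℂ}
    {B : Matrix (Fin n) (Fin m) ℂ} {C : Matrix (Fin m) (Fin n) ℂ} (hH : IsUnit H)
    (hQH : Hᴴ * H = Q) (hSH : Hᴴ * signature n k * H = S)
    (hS : ReciprocityEquations A B C S) (hQ : PassivityConditions A B C Q) :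
    (-((H * A * H⁻¹)ᴴ + H * A * H⁻¹)).PosSemidef ∧
    (H * A * H⁻¹)ᴴ * signature n k = signature n k * (H * A * H⁻¹) ∧
    signature n k * (H * B) = H * B ∧
    (H * B)ᴴ * H = C ∧
    C * S⁻¹ * Q * B = (H * B)ᴴ * (H * B) := by
  have hd : IsUnit H.det := (Matrix.isUnit_iff_isUnit_det _).1 hH
  have hdh : IsUnit Hᴴ.det := by
    rw [Matrix.det_conjTranspose]; exact hd.star
  have hi : H * H⁻¹ = 1 := Matrix.mul_nonsing_inv _ hd
  have hi' : H⁻¹ * H = 1 := Matrix.nonsing_inv_mul _ hd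
  have hih : (H⁻¹)ᴴ * Hᴴ = 1 := by rw [← Matrix.conjTranspose_mul, hi, Matrix.conjTranspose_one]
  have hih' : Hᴴ * (H⁻¹)ᴴ = 1 := by rw [← Matrix.conjTranspose_mul, hi', Matrix.conjTranspose_one]
  have hC : (H * B)ᴴ * H = C := by
    have := congrArg Matrix.conjTranspose hQ.2
    rw [Matrix.conjTranspose_conjTranspose, ← hQH] at this
    rw [this]
    simp [Matrix.conjTranspose_mul, Matrix.mul_assoc]
  have hsB : signature n k * (H * B) = H * B := by
    -- The left side is `S B` and the right side is `Q B`; both equal `C*`.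
    have h1 : Hᴴ * (signature n k * (H * B)) = Hᴴ * (H * B) := by
      rw [← Matrix.mul_assoc, ← Matrix.mul_assoc, hSH, ← hS.2, hQ.2, ← hQH, Matrix.mul_assoc]
    have h2 := congrArg (fun X => (H⁻¹)ᴴ * X) h1
    simpa only [← Matrix.mul_assoc, hih, Matrix.one_mul] using h2
  refine ⟨?_, ?_, hsB, hC, ?_⟩
  · have h1 := hQ.1.conjTranspose_mul_mul_same H⁻¹
    have h2 : (H⁻¹)ᴴ * -(Aᴴ * Q + Q * A) * H⁻¹ = -((H * A * H⁻¹)ᴴ + H * A * H⁻¹) := by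
      have e1 : (H⁻¹)ᴴ * (Aᴴ * (Hᴴ * H)) * H⁻¹ = (H * A * H⁻¹)ᴴ * (H * H⁻¹) := by
        simp only [Matrix.conjTranspose_mul, mul_assoc]
      have e2 : (H⁻¹)ᴴ * (Hᴴ * H * A) * H⁻¹ = ((H⁻¹)ᴴ * Hᴴ) * (H * A * H⁻¹) := by
        simp only [mul_assoc]
      rw [mul_neg, neg_mul, mul_add, add_mul, ← hQH, e1, e2, hi, hih, mul_one, one_mul]
    rwa [h2] at h1
  · have h1 := hS.1
    calc (H * A * H⁻¹)ᴴ * signature n k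
        = (H⁻¹)ᴴ * (Aᴴ * (Hᴴ * signature n k * H)) * H⁻¹ := by
          have : (H⁻¹)ᴴ * (Aᴴ * (Hᴴ * signature n k * H)) * H⁻¹ =
              (H * A * H⁻¹)ᴴ * signature n k * (H * H⁻¹) := by
            simp only [Matrix.conjTranspose_mul, mul_assoc]
          rw [this, hi, mul_one]
      _ = (H⁻¹)ᴴ * (Hᴴ * signature n k * H * A) * H⁻¹ := by rw [hSH, h1]
      _ = ((H⁻¹)ᴴ * Hᴴ) * (signature n k * (H * A * H⁻¹)) := by simp only [mul_assoc]
      _ = signature n k * (H * A * H⁻¹) := by rw [hih, one_mul]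
  · have hSi : S⁻¹ = H⁻¹ * signature n k * (H⁻¹)ᴴ := by
      refine Matrix.inv_eq_right_inv ?_
      rw [← hSH]
      calc Hᴴ * signature n k * H * (H⁻¹ * signature n k * (H⁻¹)ᴴ)
          = Hᴴ * (signature n k * (H * H⁻¹) * signature n k) * (H⁻¹)ᴴ := by simp only [mul_assoc]
        _ = 1 := by rw [hi, mul_one, signature_mul_self, mul_one, hih']
    rw [hSi, ← hQH, ← hC]
    calc (H * B)ᴴ * H * (H⁻¹ * signature n k * (H⁻¹)ᴴ) * (Hᴴ * H) * B
        = (H * B)ᴴ * ((H * H⁻¹) * (signature n k * (((H⁻¹)ᴴ * Hᴴ) * (H * B)))) := by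
          simp only [Matrix.mul_assoc]
      _ = (H * B)ᴴ * (H * B) := by rw [hi, hih, Matrix.one_mul, Matrix.one_mul, hsB]

end LTSI

end

theorem theorem3 (s m n : ℕ) (sys : LTSI.System s m n m)
    (hrec : sys.IsReciprocal)
    (hpas : sys.IsWeaklyImpedancePassive)
    (hmin : ∀ ω, LTSI.IsMinimal (sys.symA ω) (sys.symB ω) (sys.symC ω))
    (S Q : Space s → Matrix (Fin n) (Fin n) ℂ)
    (hS_cont : Continuous S) (hQ_cont : Continuous Q)
    (hS_inv : ∀ ω, IsUnit (S ω)) (hQ_inv : ∀ ω, IsUnit (Q ω))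
    (hS_selfAdj : ∀ ω, (S ω).IsHermitian)
    (hS : ∀ ω, LTSI.ReciprocityEquations (sys.symA ω) (sys.symB ω) (sys.symC ω) (S ω))
    (hQ_pos : ∀ ω, (Q ω).PosDef)
    (hQ : ∀ ω, LTSI.PassivityConditions (sys.symA ω) (sys.symB ω) (sys.symC ω) (Q ω))
    (hcompat : ∀ ω, Q ω = S ω * (Q ω)⁻¹ * S ω)
    (hbdd : BddAbove (Set.range fun ω =>
      ‖Matrix.toEuclideanCLM (n := Fin m) (𝕜 := ℂ)
        (sys.symC ω * (S ω)⁻¹ * Q ω * sys.symB ω)‖)) :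
    ∃ (sys' : LTSI.System s m n m) (T : LTSI.C0Semigroup (L2 s n)),
      -- `sys'` is well-posed with semigroup `T`
      T.HasGenerator sys'.A ∧
      -- it has the impulse response of `sys`
      (∀ t : ℝ, 0 ≤ t →
        LTSI.everywhere ((sys'.C.comp (T.op t)).comp sys'.B) = sys.impulseResponse t) ∧
      sys'.IsInternallyImpedancePassive T ∧
      sys'.IsSelfDual ∧
      -- the partition of the state space and of the operators
      ∃ (n₁ n₂ : ℕ) (h : n₁ + n₂ = n)
        (A₁₁ : L2 s n₁ →ₗ.[ℂ] L2 s n₁) (A₁₂ : L2 s n₂ →ₗ.[ℂ] L2 s n₁)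
        (A₂₂ : L2 s n₂ →ₗ.[ℂ] L2 s n₂) (B₁ : L2 s m →L[ℂ] L2 s n₁),
        Dense (A₁₁.domain : Set (L2 s n₁)) ∧
        Dense (A₁₂.domain : Set (L2 s n₂)) ∧
        Dense (A₂₂.domain : Set (L2 s n₂)) ∧
        LTSI.IsTranslationInvariant A₁₁ ∧
        LTSI.IsTranslationInvariant A₁₂ ∧
        LTSI.IsTranslationInvariant A₂₂ ∧
        LTSI.IsNonpositive A₁₁ ∧
        LTSI.IsNonpositive A₂₂ ∧
        sys'.A = (LTSI.block h A₁₁ A₁₂ (-A₁₂†) A₂₂).closure ∧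
        sys'.C.adjoint = sys'.B ∧
        sys'.B = (LTSI.incl₁ s h).comp B₁ := by
  obtain ⟨n₁, n₂, hn, H, hHc, hHu, hQH, hSH⟩ := LTSI.exists_normalForm hS_cont hQ_cont hS_inv hQ_inv
    hS_selfAdj hQ_pos hcompat
  have key := fun ω => LTSI.normalForm_symbols (hHu ω) (hQH ω) (hSH ω) (hS ω) (hQ ω)
  obtain ⟨K, hK⟩ := hbdd
  refine LTSI.exists_realization (a := fun ω => H ω * sys.symA ω * (H ω)⁻¹)
    (b := fun ω => H ω * sys.symB ω)
    ((hHc.mul sys.continuous_symA).mul (LTSI.continuous_matrix_inv hHc hHu))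
    (hHc.matrix_mul sys.continuous_symB) (K := √K)
    (fun ω => LTSI.norm_le_sqrt_of_conjTranspose_mul_self ?_) (fun ω => (key ω).1) hn
    (fun ω => (key ω).2.1) (fun ω => (key ω).2.2.1) sys fun t ω => ?_
  · rw [← (key ω).2.2.2.2]
    exact hK ⟨ω, rfl⟩
  · have hd : IsUnit (H ω).det := (Matrix.isUnit_iff_isUnit_det _).1 (hHu ω)
    -- The exponential of a conjugate is the conjugate of the exponential, so the factors `H⁻¹ H`
    -- cancel and `(H B)* H = C` restores the original symbol.
    rw [← Matrix.smul_mul, ← Matrix.mul_smul, Matrix.exp_conj _ _ (hHu ω),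
      ← Matrix.mul_assoc, ← Matrix.mul_assoc, Matrix.mul_assoc _ (H ω)⁻¹,
      Matrix.nonsing_inv_mul _ hd, Matrix.mul_one, ← Matrix.mul_assoc, (key ω).2.2.2.1]
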